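/- Let $n>1$, $m\in\mathbb R$, and consider the equation $$\partial_t\phi+\partial_x(\phi^n)-\partial_x\bigl[\phi^n\,\partial_x(\phi^{-m}\partial_t\phi)\bigr]=0,\qquad \phi\to1\ \text{as}\ |x|\to\infty. \tag{1}$$ For $c>n$ let $\phi_c$ be the solitary wave profile of speed $c$, when one exists: the even $C^2$ function with $\phi_c>1$, $\phi_c\to1$ at $\pm\infty$ and $$-c(\phi_c-1)+\phi_c^n-1+c\,\phi_c^n\,\partial_y(\phi_c^{-m}\partial_y\phi_c)=0 .$$ Let $$\mathcal N[\phi]=\int_{\mathbb R}\Bigl(\tfrac12\phi^{-2m}\phi_x^2+W(\phi)\Bigr)dx,$$ where $W(s)=s\log s-s+1$ if $n+m=1$, $W(s)=s-1-\log s$ if $n+m=2$, and $W(s)=\frac{s^{2-n-m}-1+(n+m-2)(s-1)}{(n+m-1)(n+m-2)}$ otherwise. For $a>0$ let $H^1_a=\{u: e^{ax}u\in H^1\}$, and set $$\gamma(c)=\sqrt{\tfrac{c-n}{c}},\qquad a_\star(c)=\min\Bigl\{\tfrac13\gamma(c),\ \tfrac12\inf_x\phi_c(x)^{(m-n)/2},\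 \tfrac12\sqrt{\tfrac{2c}{n+2c+\sqrt{n(n+8c)}}}\;\gamma(c)\Bigr\}.$$ Let $c_0>n$ be such that a solitary wave of speed $c_0$ exists, let $0<a\le a_\star(c_0)$, and assume $\partial_c\mathcal N[\phi_c]\big|_{c=c_0}\neq0$. Define $$\begin{aligned} g&=\bigl[I-\phi_{c_0}^{-m}\partial_x(\phi_{c_0}^n\partial_x\,\cdot)\bigr]\int_{-\infty}^x\frac{\partial_x\phi_{c_0}}{\phi_{c_0}^{n+m}}, &\tilde\eta_2&=\Theta\, g,\\ \tilde\eta_1&=\Theta\bigl[I-\phi_{c_0}^{-m}\partial_x(\phi_{c_0}^n\partial_x\,\cdot)\bigr]\int_{-\infty}^x (L^\star_{c_0})^{-1}g, &\Theta&=\bigl(\partial_c\mathcal N[\phi_c]|_{c=c_0}\bigr)^{-1}, \end{aligned}$$ where $L^\star_c h=-c\,\phi_c^{-m}\partial_x^2(\phi_c^n h)+\bigl[c-n\phi_c^{-1}+cn(\phi_c^{-1}-1)\bigr]h$ and $(L^\star_{c_0})^{-1}g$ is the even $L^2$ solution $h$ of $L^\star_{c_0}h=g$. Then there exist constants $K,K'>0$,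 depending only on $n,m,c_0,a$, with the following property. Let $T>0$, let $\phi$ be a positive solution of (1) with $\phi-1\in C^1([0,T];H^1\cap H^1_a)$ and data $\phi(x,0)=\phi_{c_0}(x+\theta_0)+v_0(x)$, $\theta_0\in\mathbb R$. Assume that on $[0,T]$ the modulational decomposition $$\phi(x,t)=\phi_{c(t)}(y)+v(y,t),\qquad y=x-\int_0^tc(s)\,ds+\theta(t),$$ exists, that is, $\theta,c\in C^1([0,T])$, $c(t)>n$, a solitary wave of speed $c(t)$ exists, $v(\cdot,t)\in H^1\cap H^1_a$, and $\langle v(\cdot,t),\tilde\eta_1\rangle=\langle v(\cdot,t),\tilde\eta_2\rangle=0$ for all $t\in[0,T]$. Assume also that, for some $\delta_1<1$, $|c(t)-c_0|+\|v(\cdot,t)\|_{H^1}\le\delta_1$ for all $t\in[0,T]$. Then, with $w(y,t)=e^{ay}v(y,t)$ and $\Delta\mathcal N=\mathcal N[\phi_{c(t)}+v(\cdot,t)]-\mathcal N[\phi_{c_0}]$, for all $t\in[0,T]$, $$\|v\|_{H^1}^2\bigl(1-K'\|v\|_{H^1}\bigr)\le K\Bigl(|\Delta\mathcal N|+\|w\|_{L^2}+\|w\|_{L^2}^2+|c(t)-c_0|+|c(t)-c_0|^2+|c(t)-c_0|^3\Bigr).$$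 -/

import Mathlib

open MeasureTheory Filter Topology Set
open scoped ContDiff

noncomputable section

namespace Magma

/-! Sobolev spaces on the line, through weak derivatives. -/

/-- `g` is a weak derivative of `f` on `ℝ`. -/
def IsWeakDeriv (f g : ℝ → ℝ) : Prop :=
  LocallyIntegrable f ∧ LocallyIntegrable g ∧
    ∀ ψ : ℝ → ℝ, ContDiff ℝ ∞ ψ → HasCompactSupport ψ →
      ∫ x, f x * deriv ψ x = -∫ x, g x * ψ x

/-- The weak derivative of `f` (unique almost everywhere when it exists). -/
def weakDeriv (f : ℝ → ℝ) : ℝ → ℝ := Classical.epsilon (IsWeakDeriv f)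

/-- Membership in `H¹(ℝ)`. -/
def MemH1 (f : ℝ → ℝ) : Prop :=
  MemLp f 2 volume ∧ ∃ g : ℝ → ℝ, MemLp g 2 volume ∧ IsWeakDeriv f g

/-- The norm of `L²(ℝ)`, for members of `L²(ℝ)`. -/
def l2Norm (f : ℝ → ℝ) : ℝ := Real.sqrt (∫ x, f x ^ 2)

/-- The norm of `H¹(ℝ)`, for members of `H¹(ℝ)`. -/
def h1Norm (f : ℝ → ℝ) : ℝ := Real.sqrt ((∫ x, f x ^ 2) + ∫ x, weakDeriv f x ^ 2)

/-- The exponentially weighted function `e^{ax} f(x)`. -/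
def weighted (a : ℝ) (f : ℝ → ℝ) : ℝ → ℝ := fun x => Real.exp (a * x) * f x

/-- Membership in `H¹ ∩ H¹_a`. -/
def MemH1Weighted (a : ℝ) (f : ℝ → ℝ) : Prop := MemH1 f ∧ MemH1 (weighted a f)

/-- The norm of `H¹ ∩ H¹_a`. -/
def h1WeightedNorm (a : ℝ) (f : ℝ → ℝ) : ℝ := h1Norm f + h1Norm (weighted a f)

/-- `u` belongs to `C¹([0,T]; H¹ ∩ H¹_a)` and its time derivative is `ut`. -/
structure IsC1Curve (a T : ℝ) (u ut : ℝ → ℝ → ℝ) : Prop where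
  mem : ∀ t ∈ Icc 0 T, MemH1Weighted a (u t)
  mem_deriv : ∀ t ∈ Icc 0 T, MemH1Weighted a (ut t)
  hasDeriv : ∀ t ∈ Icc 0 T,
    Tendsto (fun s => h1WeightedNorm a (fun x => (u s x - u t x) / (s - t) - ut t x))
      (𝓝[Icc 0 T \ {t}] t) (𝓝 0)
  cont_deriv : ∀ t ∈ Icc 0 T,
    Tendsto (fun s => h1WeightedNorm a (fun x => ut s x - ut t x)) (𝓝[Icc 0 T] t) (𝓝 0)

/-! The equation `∂ₜφ + ∂ₓ(φⁿ) - ∂ₓ[φⁿ ∂ₓ(φ⁻ᵐ ∂ₜφ)] = 0` and its solitary waves. -/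

/-- `φ` is a positive solution on `[0,T]` with `φ - 1 ∈ C¹([0,T]; H¹ ∩ H¹_a)`; the equation
holds at every time in the sense of distributions in `x`. Here `φ t x` is the value at time `t`. -/
def IsSolution (n m a T : ℝ) (φ : ℝ → ℝ → ℝ) : Prop :=
  (∀ t ∈ Icc 0 T, ∀ᵐ x, 0 < φ t x) ∧
  ∃ φt : ℝ → ℝ → ℝ, IsC1Curve a T (fun t x => φ t x - 1) φt ∧
    ∀ t ∈ Icc 0 T, ∀ ψ : ℝ → ℝ, ContDiff ℝ ∞ ψ → HasCompactSupport ψ →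
      (∫ x, φt t x * ψ x) - (∫ x, φ t x ^ n * deriv ψ x)
        + (∫ x, φ t x ^ n * weakDeriv (fun z => φ t z ^ (-m) * φt t z) x * deriv ψ x) = 0

/-- `ψ` is the profile of a solitary wave of speed `c`: an even solution, in excess of the
reference state `1` and tending to it at infinity, of the once integrated profile equation. -/
structure IsSolitaryWave (n m c : ℝ) (ψ : ℝ → ℝ) : Prop where
  smooth : ContDiff ℝ 2 ψ
  one_lt : ∀ y, 1 < ψ y
  even : ∀ y, ψ (-y) = ψ y
  tendsto_atTop : Tendsto ψ atTop (𝓝 1)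
  tendsto_atBot : Tendsto ψ atBot (𝓝 1)
  profile : ∀ y, -c * (ψ y - 1) + ψ y ^ n - 1
    + c * ψ y ^ n * deriv (fun z => ψ z ^ (-m) * deriv ψ z) y = 0

/-- A solitary wave of speed `c` exists. -/
def HasSolitaryWave (n m c : ℝ) : Prop := ∃ ψ : ℝ → ℝ, IsSolitaryWave n m c ψ

/-- The solitary wave profile `φ_c` (meaningful when `HasSolitaryWave n m c`). -/
def solitaryWave (n m c : ℝ) : ℝ → ℝ := Classical.epsilon (IsSolitaryWave n m c)

/-! The invariant functional. -/

/-- The part of the density of `𝒩` that does not involve the derivative. -/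
def potential (n m s : ℝ) : ℝ :=
  if n + m = 1 then s * Real.log s - s + 1
  else if n + m = 2 then s - 1 - Real.log s
  else (s ^ (2 - n - m) - 1 + (n + m - 2) * (s - 1)) / ((n + m - 1) * (n + m - 2))

/-- The invariant `𝒩[φ]`. -/
def energy (n m : ℝ) (φ : ℝ → ℝ) : ℝ :=
  ∫ x, (1 / 2 * φ x ^ (-2 * m) * weakDeriv φ x ^ 2 + potential n m (φ x))

/-- `∂_c 𝒩[φ_c]`. -/
def energySlope (n m c : ℝ) : ℝ := deriv (fun s => energy n m (solitaryWave n m s)) c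

/-! The bound on the exponential weight. -/

def gam (n c : ℝ) : ℝ := Real.sqrt ((c - n) / c)

def aStar (n m c : ℝ) : ℝ :=
  min (1 / 3 * gam n c)
    (min (1 / 2 * ⨅ x : ℝ, solitaryWave n m c x ^ ((m - n) / 2))
      (1 / 2 * (Real.sqrt (2 * c / (n + 2 * c + Real.sqrt (n * (n + 8 * c))))
        * Real.sqrt ((c - n) / c))))

/-! The adjoint generalized kernel and the modulational decomposition. -/

/-- The operator `I - φ⁻ᵐ ∂(φⁿ ∂ ·)`. -/
def adjOp (n m : ℝ) (φ f : ℝ → ℝ) : ℝ → ℝ :=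
  fun x => f x - φ x ^ (-m) * deriv (fun z => φ z ^ n * deriv f z) x

/-- The formal adjoint `L_c^⋆` of
`L_c v = -c φⁿ ∂²(φ⁻ᵐ v) + [c - n φ⁻¹ + c n (φ⁻¹ - 1)] v`, at `φ = φ_c`. -/
def LStar (n m c : ℝ) (φ h : ℝ → ℝ) : ℝ → ℝ :=
  fun x => -c * φ x ^ (-m) * deriv (deriv (fun z => φ z ^ n * h z)) x
    + (c - n * (φ x)⁻¹ + c * n * ((φ x)⁻¹ - 1)) * h x

/-- The antiderivative from `-∞`. -/
def primitive (f : ℝ → ℝ) : ℝ → ℝ := fun x => ∫ s in Iic x, f s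

/-- The function `[I - φ⁻ᵐ ∂(φⁿ ∂ ·)] ∫_{-∞}^x φ^{-n-m} ∂φ`, at `φ = φ_c`. -/
def eta2Core (n m c : ℝ) : ℝ → ℝ :=
  let φ := solitaryWave n m c
  adjOp n m φ (primitive (fun s => deriv φ s / φ s ^ (n + m)))

/-- `h = (L_c^⋆)⁻¹ (eta2Core)`. The kernel of `L_c^⋆` is spanned by an odd function, so
the even square integrable preimage is the only one. -/
structure IsLStarPreimage (n m c : ℝ) (h : ℝ → ℝ) : Prop where
  smooth : ContDiff ℝ 2 h
  even : ∀ x, h (-x) = h x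
  memLp : MemLp h 2 volume
  eq : ∀ x, LStar n m c (solitaryWave n m c) h x = eta2Core n m c x

/-- `η̃₂`. -/
def eta2 (n m c : ℝ) : ℝ → ℝ := fun x => (energySlope n m c)⁻¹ * eta2Core n m c x

/-- `η̃₁`, written with the preimage `h = (L_c^⋆)⁻¹ (eta2Core)`. -/
def eta1 (n m c : ℝ) (h : ℝ → ℝ) : ℝ → ℝ :=
  fun x => (energySlope n m c)⁻¹ * adjOp n m (solitaryWave n m c) (primitive h) x

/-- The moving coordinate `y = x - ∫₀ᵗ c + θ(t)`. -/
def movingCoord (θ c : ℝ → ℝ) (t x : ℝ) : ℝ := x - (∫ s in (0 : ℝ)..t, c s) + θ t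

/-- The decomposition `φ(x,t) = φ_{c(t)}(y) + v(y,t)` on `[0,T]`, with `v(·,t) ∈ H¹ ∩ H¹_a`
orthogonal to `η̃₁`, `η̃₂` taken at the speed `c₀`. -/
structure IsDecomposition (n m c₀ a T : ℝ) (φ v : ℝ → ℝ → ℝ) (θ c : ℝ → ℝ) : Prop where
  smooth_phase : ContDiffOn ℝ 1 θ (Icc 0 T)
  smooth_speed : ContDiffOn ℝ 1 c (Icc 0 T)
  speed_gt : ∀ t ∈ Icc 0 T, n < c t
  wave : ∀ t ∈ Icc 0 T, HasSolitaryWave n m (c t)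
  mem : ∀ t ∈ Icc 0 T, MemH1Weighted a (v t)
  decomp : ∀ t ∈ Icc 0 T, ∀ x,
    φ t x = solitaryWave n m (c t) (movingCoord θ c t x) + v t (movingCoord θ c t x)
  orth₁ : ∀ t ∈ Icc 0 T, ∀ h, IsLStarPreimage n m c₀ h → ∫ y, v t y * eta1 n m c₀ h y = 0
  orth₂ : ∀ t ∈ Icc 0 T, ∫ y, v t y * eta2 n m c₀ y = 0

end Magma

end

noncomputable section

namespace Magma

/-! ### Weak derivatives on the line -/

/-! Write N for the functional `energy`, ψ for a solitary wave of speed c near c₀, and expand N[ψ +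
v] around ψ. The part quadratic in v is coercive in H¹: the coefficient ψ^(-2m) is bounded below and
the potential W satisfies W''(s) = s^(-n-m) > 0 (`exists_density_lower_bound`). The part linear in v
has exponentially localized coefficients once the derivative is moved off v by parts. If they decay
like e^(-b|y|) with b > a, then e^(-b|y|)|v| ≤ e^(-(b-a)|y|)|w|, so Cauchy–Schwarz bounds the linear
part by ‖w‖ in L². This gives `exists_coercivity`: k‖v‖² ≤ N[ψ + v] - N[ψ] + Λ‖w‖.

Here b = γ(c₀)/2, which exceeds a because a ≤ γ(c₀)/3. The constants must not depend on the speed,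
so the decay must be uniform for c near c₀ (`exists_isLocalizedProfile`). It comes from the first
integral (c/2)(ψ^(-m)ψ')² = P(ψ), where P is `profilePotential`: P has a single zero beyond 1, the
height of the crest, and grows quadratically near 1. A compactness argument bounds the distance at
which the wave enters a fixed neighbourhood of 1.

Finally N[ψ] - N[φ_{c₀}] = O(|c - c₀|) by differentiability in c. This settles small v and c near
c₀; when ‖v‖ ≥ 1/4 or |c - c₀| is not small, the claim holds by the choice of K' and K. -/

lemma intervalIntegrable_of_locallyIntegrable {g : ℝ → ℝ} (hg : LocallyIntegrable g) (a b : ℝ) :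
    IntervalIntegrable g volume a b :=
  intervalIntegrable_iff.mpr <|
    (hg.integrableOn_isCompact isCompact_uIcc).mono_set uIoc_subset_uIcc

lemma absolutelyContinuousOnInterval_primitive {g : ℝ → ℝ} (hg : LocallyIntegrable g)
    (C a b : ℝ) :
    AbsolutelyContinuousOnInterval (fun x => C + ∫ t in (0 : ℝ)..x, g t) a b := by
  have hc : AbsolutelyContinuousOnInterval (fun _ : ℝ => C) a b :=
    contDiff_const.contDiffOn.absolutelyContinuousOnInterval
  refine hc.fun_add ?_
  have h := (intervalIntegrable_of_locallyIntegrable hg (-(|a| + |b|)) (|a| + |b|))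
    |>.absolutelyContinuousOnInterval_intervalIntegral (c := 0)
      (by rw [uIcc_of_le (by linarith [abs_nonneg a, abs_nonneg b])]
          constructor <;> linarith [abs_nonneg a, abs_nonneg b])
  refine h.mono ?_
  refine uIcc_subset_uIcc ?_ ?_ <;> rw [uIcc_of_le (by linarith [abs_nonneg a, abs_nonneg b])] <;>
    constructor <;>
    linarith [abs_nonneg a, abs_nonneg b, le_abs_self a, le_abs_self b, neg_abs_le a, neg_abs_le b]

lemma ae_deriv_primitive {g : ℝ → ℝ} (hg : LocallyIntegrable g) (C : ℝ) :
    deriv (fun x => C + ∫ t in (0 : ℝ)..x, g t) =ᵐ[volume] g := by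
  filter_upwards [LocallyIntegrable.ae_hasDerivAt_integral hg] with x hx
  exact ((hx 0).const_add C).deriv

lemma integral_mul_eq_sub_primitive {F g : ℝ → ℝ} (hF : ContDiff ℝ 1 F)
    (hg : LocallyIntegrable g) (C a b : ℝ) :
    ∫ x in a..b, F x * g x = F b * (C + ∫ t in (0 : ℝ)..b, g t)
      - F a * (C + ∫ t in (0 : ℝ)..a, g t)
      - ∫ x in a..b, deriv F x * (C + ∫ t in (0 : ℝ)..x, g t) := by
  have h1 : AbsolutelyContinuousOnInterval F a b :=
    hF.contDiffOn.absolutelyContinuousOnInterval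
  rw [← h1.integral_mul_deriv_eq_deriv_mul (absolutelyContinuousOnInterval_primitive hg C a b)]
  refine intervalIntegral.integral_congr_ae ?_
  filter_upwards [ae_deriv_primitive hg C] with x hx _
  rw [hx]

lemma continuous_primitive_add {g : ℝ → ℝ} (hg : LocallyIntegrable g) (C : ℝ) :
    Continuous (fun x => C + ∫ t in (0 : ℝ)..x, g t) :=
  continuous_const.add
    (intervalIntegral.continuous_primitive (intervalIntegrable_of_locallyIntegrable hg) 0)

lemma exists_interval_of_hasCompactSupport {F : ℝ → ℝ} (hF : HasCompactSupport F) :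
    ∃ R : ℝ, 0 < R ∧ ∀ x, R ≤ |x| → F x = 0 := by
  obtain ⟨R, hR⟩ := hF.isBounded.exists_norm_le
  refine ⟨|R| + 1, by positivity, fun x hx => ?_⟩
  by_contra h
  have := hR x (subset_tsupport _ h)
  rw [Real.norm_eq_abs] at this
  linarith [le_abs_self R]

lemma integral_eq_intervalIntegral {F : ℝ → ℝ} {R : ℝ} (hR : 0 < R)
    (h : ∀ x, R ≤ |x| → F x = 0) : ∫ x, F x = ∫ x in (-R)..R, F x := by
  rw [intervalIntegral.integral_of_le (by linarith)]
  refine (setIntegral_eq_integral_of_forall_compl_eq_zero fun x hx => h x ?_).symm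
  by_contra hlt
  rw [not_le, abs_lt] at hlt
  exact hx ⟨hlt.1, hlt.2.le⟩

lemma isWeakDeriv_primitive {g : ℝ → ℝ} (hg : LocallyIntegrable g) (C : ℝ) :
    IsWeakDeriv (fun x => C + ∫ t in (0 : ℝ)..x, g t) g := by
  refine ⟨(continuous_primitive_add hg C).locallyIntegrable, hg, fun ψ hψ hψc => ?_⟩
  obtain ⟨R, hR, h0⟩ := exists_interval_of_hasCompactSupport hψc
  obtain ⟨R', hR', h0'⟩ := exists_interval_of_hasCompactSupport hψc.deriv
  have hmax : 0 < max R R' := lt_max_of_lt_left hR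
  rw [integral_eq_intervalIntegral (R := max R R') hmax
      (fun x hx => by rw [h0' x ((le_max_right _ _).trans hx), mul_zero]),
    integral_eq_intervalIntegral (R := max R R') hmax
      (fun x hx => by rw [h0 x ((le_max_left _ _).trans hx), mul_zero])]
  have key := integral_mul_eq_sub_primitive (hψ.of_le (by exact_mod_cast le_top)) hg C
    (-(max R R')) (max R R')
  rw [h0 (max R R') (by rw [abs_of_pos hmax]; exact le_max_left _ _),
    h0 (-(max R R')) (by rw [abs_neg, abs_of_pos hmax]; exact le_max_left _ _)] at key
  simp only [zero_mul, sub_zero, zero_sub] at key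
  simp_rw [mul_comm (g _)]
  rw [key, neg_neg]
  simp_rw [mul_comm]

/-- The primitive started to the left of the support vanishes again on the right because the mean is
zero. -/
lemma exists_deriv_eq_of_integral_eq_zero {η : ℝ → ℝ} (hη : ContDiff ℝ ∞ η)
    (hc : HasCompactSupport η) (h0 : ∫ x, η x = 0) :
    ∃ ψ : ℝ → ℝ, ContDiff ℝ ∞ ψ ∧ HasCompactSupport ψ ∧ deriv ψ = η := by
  obtain ⟨R, hR, hz⟩ := exists_interval_of_hasCompactSupport hc
  have hd : ∀ x, HasDerivAt (fun x => ∫ t in (-R)..x, η t) (η x) x := fun x =>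
    intervalIntegral.integral_hasDerivAt_right (hη.continuous.intervalIntegrable _ _)
      (hη.continuous.stronglyMeasurableAtFilter _ _) hη.continuous.continuousAt
  have hdd : deriv (fun x => ∫ t in (-R)..x, η t) = η := funext fun x => (hd x).deriv
  refine ⟨fun x => ∫ t in (-R)..x, η t, ?_, ?_, hdd⟩
  · rw [contDiff_infty_iff_deriv, hdd]
    exact ⟨fun x => (hd x).differentiableAt, hη⟩
  · refine HasCompactSupport.intro (K := Icc (-R) R) isCompact_Icc fun x hx => ?_
    rcases lt_or_ge x (-R) with h | h
    · rw [intervalIntegral.integral_symm]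
      rw [intervalIntegral.integral_congr (g := fun _ => (0 : ℝ))]
      · simp
      · intro t ht
        rw [uIcc_of_le h.le] at ht
        exact hz t (by rw [abs_of_nonpos (by linarith [ht.2])]; linarith [ht.2])
    · have hx' : R < x := by
        by_contra hle
        exact hx ⟨h, not_lt.mp hle⟩
      rw [← intervalIntegral.integral_add_adjacent_intervals (b := R)
        (hη.continuous.intervalIntegrable _ _) (hη.continuous.intervalIntegrable _ _),
        ← integral_eq_intervalIntegral hR hz, h0, zero_add,
        intervalIntegral.integral_congr (g := fun _ => (0 : ℝ))]
      · simp
      · intro t ht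
        rw [uIcc_of_le hx'.le] at ht
        exact hz t (ht.1.trans (le_abs_self t))

lemma integrable_mul_test {f ψ : ℝ → ℝ} (hf : LocallyIntegrable f) (hψ : Continuous ψ)
    (hc : HasCompactSupport ψ) : Integrable (fun x => f x * ψ x) := by
  have := hf.integrable_smul_left_of_hasCompactSupport hψ hc
  simpa [mul_comm] using this

/-- Du Bois-Reymond: subtracting from a test function its mean times a fixed bump ρ of mass 1 leaves
the derivative of a test function. So f acts on test functions as the constant ∫ fρ. -/
lemma ae_const_of_isWeakDeriv_zero {f : ℝ → ℝ} (hf : LocallyIntegrable f)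
    (h : ∀ ψ : ℝ → ℝ, ContDiff ℝ ∞ ψ → HasCompactSupport ψ → ∫ x, f x * deriv ψ x = 0) :
    ∃ C : ℝ, ∀ᵐ x, f x = C := by
  let B : ContDiffBump (0 : ℝ) := ⟨1, 2, one_pos, one_lt_two⟩
  let ρ : ℝ → ℝ := B.normed volume
  have hρ : ContDiff ℝ ∞ ρ := B.contDiff_normed
  have hρc : HasCompactSupport ρ := B.hasCompactSupport_normed
  have hρ1 : ∫ x, ρ x = 1 := B.integral_normed
  have hρi : Integrable ρ := hρ.continuous.integrable_of_hasCompactSupport hρc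
  refine ⟨∫ x, f x * ρ x, ?_⟩
  refine ae_eq_of_integral_contDiff_smul_eq hf (locallyIntegrable_const _) fun η hη hηc => ?_
  have hηi : Integrable η := hη.continuous.integrable_of_hasCompactSupport hηc
  obtain ⟨ψ, hψ, hψc, hd⟩ := exists_deriv_eq_of_integral_eq_zero
    (η := fun x => η x - (∫ y, η y) * ρ x) (hη.sub (contDiff_const.mul hρ))
    (hηc.sub hρc.mul_left) (by
      rw [integral_sub hηi (hρi.const_mul _), integral_const_mul, hρ1, mul_one, sub_self])
  have key := h ψ hψ hψc
  simp_rw [hd, mul_sub] at key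
  have hi1 := integrable_mul_test hf hη.continuous hηc
  have hi2 := integrable_mul_test hf hρ.continuous hρc
  have e : ∀ x, f x * ((∫ y, η y) * ρ x) = (∫ y, η y) * (f x * ρ x) := fun x => by ring
  simp_rw [e] at key
  rw [integral_sub hi1 (hi2.const_mul _), integral_const_mul] at key
  simp_rw [smul_eq_mul]
  rw [integral_mul_const]
  simp_rw [mul_comm (η _)]
  linarith

lemma IsWeakDeriv.exists_ae_eq_primitive {f g : ℝ → ℝ} (h : IsWeakDeriv f g) :
    ∃ C : ℝ, f =ᵐ[volume] fun x => C + ∫ t in (0 : ℝ)..x, g t := by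
  obtain ⟨hf, hg, hfg⟩ := h
  have hp := isWeakDeriv_primitive hg 0
  obtain ⟨C, hC⟩ := ae_const_of_isWeakDeriv_zero (hf.sub hp.1) fun ψ hψ hψc => by
    have hd : Continuous (deriv ψ) := hψ.continuous_deriv (by simp)
    simp_rw [Pi.sub_apply, sub_mul]
    rw [integral_sub (integrable_mul_test hf hd hψc.deriv)
      (integrable_mul_test hp.1 hd hψc.deriv), hfg ψ hψ hψc, hp.2.2 ψ hψ hψc, sub_self]
  refine ⟨C, ?_⟩
  filter_upwards [hC] with x hx
  simp only [Pi.sub_apply, zero_add] at hx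
  linarith

lemma IsWeakDeriv.ae_unique {f g₁ g₂ : ℝ → ℝ} (h₁ : IsWeakDeriv f g₁) (h₂ : IsWeakDeriv f g₂) :
    g₁ =ᵐ[volume] g₂ := by
  refine ae_eq_of_integral_contDiff_smul_eq h₁.2.1 h₂.2.1 fun ψ hψ hψc => ?_
  simp_rw [smul_eq_mul, mul_comm (ψ _)]
  have e₁ := h₁.2.2 ψ hψ hψc
  have e₂ := h₂.2.2 ψ hψ hψc
  linarith

lemma IsWeakDeriv.add {f₁ f₂ g₁ g₂ : ℝ → ℝ} (h₁ : IsWeakDeriv f₁ g₁) (h₂ : IsWeakDeriv f₂ g₂) :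
    IsWeakDeriv (fun x => f₁ x + f₂ x) (fun x => g₁ x + g₂ x) := by
  refine ⟨h₁.1.add h₂.1, h₁.2.1.add h₂.2.1, fun ψ hψ hψc => ?_⟩
  have hd : Continuous (deriv ψ) := hψ.continuous_deriv (by simp)
  simp_rw [add_mul]
  rw [integral_add (integrable_mul_test h₁.1 hd hψc.deriv)
      (integrable_mul_test h₂.1 hd hψc.deriv),
    integral_add (integrable_mul_test h₁.2.1 hψ.continuous hψc)
      (integrable_mul_test h₂.2.1 hψ.continuous hψc), h₁.2.2 ψ hψ hψc, h₂.2.2 ψ hψ hψc]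
  ring

lemma isWeakDeriv_deriv {f : ℝ → ℝ} (hf : ContDiff ℝ 1 f) : IsWeakDeriv f (deriv f) := by
  have hd : Continuous (deriv f) := hf.continuous_deriv le_rfl
  have e : f = fun x => f 0 + ∫ t in (0 : ℝ)..x, deriv f t := by
    funext x
    rw [intervalIntegral.integral_deriv_eq_sub
      (fun y _ => (hf.differentiable one_ne_zero).differentiableAt)
      (hd.intervalIntegrable _ _)]
    ring
  have := isWeakDeriv_primitive hd.locallyIntegrable (f 0)
  rwa [← e] at this

/-- The choice made by `Classical.epsilon` is harmless: weak derivatives agree almost everywhere,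
and only integrals of them occur. -/
lemma IsWeakDeriv.weakDeriv_ae_eq {f g : ℝ → ℝ} (h : IsWeakDeriv f g) :
    weakDeriv f =ᵐ[volume] g :=
  IsWeakDeriv.ae_unique (Classical.epsilon_spec (p := IsWeakDeriv f) ⟨g, h⟩) h

lemma MemH1.isWeakDeriv {f : ℝ → ℝ} (h : MemH1 f) : IsWeakDeriv f (weakDeriv f) := by
  obtain ⟨_, g, _, hg⟩ := h
  exact Classical.epsilon_spec (p := IsWeakDeriv f) ⟨g, hg⟩

lemma MemH1.memLp_weakDeriv {f : ℝ → ℝ} (h : MemH1 f) : MemLp (weakDeriv f) 2 volume := by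
  obtain ⟨_, g, hg, hfg⟩ := h
  exact hg.ae_eq hfg.weakDeriv_ae_eq.symm

/-! ### Norm inequalities and the sup bound in H¹ -/

lemma h1Norm_sq (f : ℝ → ℝ) :
    h1Norm f ^ 2 = (∫ x, f x ^ 2) + ∫ x, weakDeriv f x ^ 2 :=
  Real.sq_sqrt (add_nonneg (integral_nonneg fun _ => sq_nonneg _)
    (integral_nonneg fun _ => sq_nonneg _))

lemma h1Norm_nonneg (f : ℝ → ℝ) : 0 ≤ h1Norm f := Real.sqrt_nonneg _

lemma l2Norm_nonneg (f : ℝ → ℝ) : 0 ≤ l2Norm f := Real.sqrt_nonneg _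

lemma integral_abs_mul_le {f g : ℝ → ℝ} {μ : Measure ℝ} (hf : MemLp f 2 μ) (hg : MemLp g 2 μ) :
    ∫ x, |f x * g x| ∂μ ≤ Real.sqrt (∫ x, f x ^ 2 ∂μ) * Real.sqrt (∫ x, g x ^ 2 ∂μ) := by
  have h := integral_mul_norm_le_Lp_mul_Lq (p := 2) (q := 2) (f := f) (g := g) (μ := μ)
    (by constructor <;> norm_num) (by simpa using hf) (by simpa using hg)
  simp only [Real.norm_eq_abs] at h
  simp_rw [abs_mul]
  refine h.trans (le_of_eq ?_)
  rw [Real.sqrt_eq_rpow, Real.sqrt_eq_rpow]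
  congr 3 <;> (ext x; simp)

lemma integral_Icc_abs_le_l2Norm {f : ℝ → ℝ} (hf : MemLp f 2 volume) (x : ℝ) :
    ∫ y in x..x + 1, |f y| ≤ l2Norm f := by
  rw [intervalIntegral.integral_of_le (by linarith)]
  have h1 : MemLp (fun _ : ℝ => (1 : ℝ)) 2 (volume.restrict (Ioc x (x + 1))) :=
    memLp_const 1
  have h := integral_abs_mul_le (hf.restrict (Ioc x (x + 1))) h1
  simp only [mul_one, one_pow] at h
  refine h.trans ?_
  have e : ∫ _ in Ioc x (x + 1), (1 : ℝ) = 1 := by simp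
  rw [e, Real.sqrt_one, mul_one]
  exact Real.sqrt_le_sqrt (setIntegral_le_integral hf.integrable_sq
    (Eventually.of_forall fun y => sq_nonneg _))

lemma l2Norm_le_h1Norm (f : ℝ → ℝ) : l2Norm f ≤ h1Norm f :=
  Real.sqrt_le_sqrt (le_add_of_nonneg_right (integral_nonneg fun _ => sq_nonneg _))

lemma l2Norm_weakDeriv_le_h1Norm (f : ℝ → ℝ) : l2Norm (weakDeriv f) ≤ h1Norm f :=
  Real.sqrt_le_sqrt (le_add_of_nonneg_left (integral_nonneg fun _ => sq_nonneg _))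

/-- Members of `H¹(ℝ)` have a continuous representative that is bounded by twice the norm. -/
lemma MemH1.exists_primitive {f : ℝ → ℝ} (h : MemH1 f) :
    ∃ C : ℝ, (f =ᵐ[volume] fun x => C + ∫ t in (0 : ℝ)..x, weakDeriv f t) ∧
      ∀ x, |C + ∫ t in (0 : ℝ)..x, weakDeriv f t| ≤ 2 * h1Norm f := by
  obtain ⟨C, hC⟩ := h.isWeakDeriv.exists_ae_eq_primitive
  refine ⟨C, hC, fun x => ?_⟩
  set V : ℝ → ℝ := fun x => C + ∫ t in (0 : ℝ)..x, weakDeriv f t with hV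
  have hg := h.isWeakDeriv.2.1
  have hgi := intervalIntegrable_of_locallyIntegrable hg
  have hVc : Continuous V := continuous_primitive_add hg C
  -- Averaging this over the unit interval to the right of x bounds |V x| by two L¹ norms there,
  -- each at most an L² norm by Cauchy–Schwarz.
  have hpt : ∀ y ∈ Icc x (x + 1), |V x| ≤ |V y| + ∫ t in x..x + 1, |weakDeriv f t| := by
    intro y hy
    have e : V y - V x = ∫ t in x..y, weakDeriv f t := by
      simp only [hV, add_sub_add_left_eq_sub]
      exact intervalIntegral.integral_interval_sub_left (hgi _ _) (hgi _ _)
    have h1 : |V y - V x| ≤ ∫ t in x..x + 1, |weakDeriv f t| := by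
      rw [e]
      refine (intervalIntegral.abs_integral_le_integral_abs hy.1).trans ?_
      refine intervalIntegral.integral_mono_interval le_rfl hy.1 hy.2 ?_ (hgi _ _).abs
      exact Eventually.of_forall fun t => abs_nonneg _
    have h2 : |V x| - |V y| ≤ |V x - V y| := abs_sub_abs_le_abs_sub _ _
    rw [abs_sub_comm] at h2
    linarith
  have hci : ∀ k : ℝ, IntervalIntegrable (fun _ : ℝ => k) volume x (x + 1) := fun k =>
    continuous_const.intervalIntegrable _ _
  have hVi := hVc.abs.intervalIntegrable (μ := volume) x (x + 1)
  have hint := intervalIntegral.integral_mono_on (a := x) (b := x + 1) (by linarith)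
    (hci _) (hVi.add (hci _)) hpt
  rw [intervalIntegral.integral_add hVi (hci _)] at hint
  simp only [intervalIntegral.integral_const, add_sub_cancel_left, one_smul] at hint
  have hVf : ∫ y in x..x + 1, |V y| = ∫ y in x..x + 1, |f y| := by
    refine intervalIntegral.integral_congr_ae ?_
    filter_upwards [hC] with y hy _
    rw [hy]
  rw [hVf] at hint
  have b1 := integral_Icc_abs_le_l2Norm h.1 x
  have b2 := integral_Icc_abs_le_l2Norm h.memLp_weakDeriv x
  linarith [l2Norm_le_h1Norm f, l2Norm_weakDeriv_le_h1Norm f]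

lemma MemH1.ae_abs_le {f : ℝ → ℝ} (h : MemH1 f) : ∀ᵐ x, |f x| ≤ 2 * h1Norm f := by
  obtain ⟨C, hC, hb⟩ := h.exists_primitive
  filter_upwards [hC] with x hx
  rw [hx]
  exact hb x

/-- Integrate by parts on [-R, R]: the boundary terms disappear as R grows, since F tends to 0 while
the continuous representative of f stays bounded. -/
lemma MemH1.integral_mul_weakDeriv {f F : ℝ → ℝ} (h : MemH1 f) (hF : ContDiff ℝ 1 F)
    (hF2 : MemLp F 2 volume) (hF2' : MemLp (deriv F) 2 volume)
    (htop : Tendsto F atTop (𝓝 0)) (hbot : Tendsto F atBot (𝓝 0)) :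
    ∫ x, F x * weakDeriv f x = -∫ x, deriv F x * f x := by
  obtain ⟨C, hC, hb⟩ := h.exists_primitive
  set V : ℝ → ℝ := fun x => C + ∫ t in (0 : ℝ)..x, weakDeriv f t with hV
  have hi1 : Integrable (fun x => F x * weakDeriv f x) := hF2.integrable_mul h.memLp_weakDeriv
  have hi2 : Integrable (fun x => deriv F x * f x) := hF2'.integrable_mul h.1
  have hz : ∀ {l : Filter ℝ}, Tendsto F l (𝓝 0) → Tendsto (fun x => F x * V x) l (𝓝 0) :=
    fun hl => hl.zero_mul_isBoundedUnder_le
      ⟨2 * h1Norm f, by simpa using Eventually.of_forall hb⟩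
  have t1 := intervalIntegral_tendsto_integral hi1 tendsto_neg_atTop_atBot tendsto_id
  have t2 := intervalIntegral_tendsto_integral hi2 tendsto_neg_atTop_atBot tendsto_id
  have t3 : Tendsto (fun R : ℝ => F R * V R - F (-R) * V (-R)
      - ∫ x in (-R)..R, deriv F x * f x) atTop (𝓝 (0 - 0 - ∫ x, deriv F x * f x)) :=
    ((hz htop).sub ((hz hbot).comp tendsto_neg_atTop_atBot)).sub t2
  have heq : (fun R : ℝ => F R * V R - F (-R) * V (-R) - ∫ x in (-R)..R, deriv F x * f x)
      = fun R => ∫ x in (-R)..R, F x * weakDeriv f x := by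
    funext R
    rw [integral_mul_eq_sub_primitive hF h.isWeakDeriv.2.1 C]
    congr 1
    refine intervalIntegral.integral_congr_ae ?_
    filter_upwards [hC] with x hx _
    rw [hx]
  rw [heq] at t3
  have := tendsto_nhds_unique t1 t3
  simpa using this

/-! ### The first integral of the profile equation -/

/-- The right-hand side `c (s - 1) - (sⁿ - 1)` of the profile equation. -/
def profileForce (n c s : ℝ) : ℝ := c * (s - 1) - (s ^ n - 1)

/-- The potential of the profile equation in the variable `ψ`. -/
def profilePotential (n m c s : ℝ) : ℝ := ∫ r in (1 : ℝ)..s, profileForce n c r * r ^ (-n - m)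

lemma profileForce_one (n c : ℝ) : profileForce n c 1 = 0 := by simp [profileForce]

lemma profilePotential_one (n m c : ℝ) : profilePotential n m c 1 = 0 := by
  simp [profilePotential]

lemma continuousOn_profileForce (n c : ℝ) : ContinuousOn (profileForce n c) (Ioi 0) := by
  unfold profileForce
  refine ContinuousOn.sub (by fun_prop) (ContinuousOn.sub ?_ continuousOn_const)
  exact continuousOn_id.rpow_const fun _ hx => Or.inl (ne_of_gt hx)

lemma continuousOn_profileDensity (n m c : ℝ) :
    ContinuousOn (fun r => profileForce n c r * r ^ (-n - m)) (Ioi 0) :=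
  (continuousOn_profileForce n c).mul
    (continuousOn_id.rpow_const fun _ hx => Or.inl (ne_of_gt hx))

lemma intervalIntegrable_of_continuousOn_Ioi {f : ℝ → ℝ} (hf : ContinuousOn f (Ioi 0)) {s t : ℝ}
    (hs : 0 < s) (ht : 0 < t) : IntervalIntegrable f volume s t :=
  (hf.mono fun _ hx => lt_of_lt_of_le (lt_min hs ht) hx.1).intervalIntegrable

lemma hasDerivAt_profilePotential (n m c : ℝ) {s : ℝ} (hs : 0 < s) :
    HasDerivAt (profilePotential n m c) (profileForce n c s * s ^ (-n - m)) s := by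
  have hc := continuousOn_profileDensity n m c
  exact intervalIntegral.integral_hasDerivAt_right
    (intervalIntegrable_of_continuousOn_Ioi hc one_pos hs)
    (hc.stronglyMeasurableAtFilter isOpen_Ioi s hs) (hc.continuousAt (Ioi_mem_nhds hs))

lemma strictConcaveOn_profileForce {n : ℝ} (hn : 1 < n) (c : ℝ) :
    StrictConcaveOn ℝ (Ici 0) (profileForce n c) := by
  have h1 : StrictConcaveOn ℝ (Ici (0 : ℝ)) (fun s : ℝ => -(s ^ n)) := (strictConvexOn_rpow hn).neg
  refine ⟨convex_Ici 0, fun x hx y hy hxy a b ha hb hab => ?_⟩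
  have := h1.2 hx hy hxy ha hb hab
  simp only [smul_eq_mul, profileForce] at this ⊢
  have hb' : b = 1 - a := by linarith
  subst hb'
  linarith

/-- The force is strictly concave and vanishes at 1. If its chord from 1 to s has nonpositive slope,
every later chord has negative slope, so beyond 1 the sign can only change from positive to
negative. -/
lemma profileForce_lt_of_nonpos {n c s t : ℝ} (hn : 1 < n) (hs : 1 < s) (hst : s < t)
    (h : profileForce n c s ≤ 0) : profileForce n c t < profileForce n c s := by
  have := (strictConcaveOn_profileForce hn c).slope_anti_adjacent (x := 1) (y := s) (z := t)
    (by simp) (by simp; linarith) hs hst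
  rw [profileForce_one, sub_zero] at this
  have h2 : profileForce n c s / (s - 1) ≤ 0 := div_nonpos_of_nonpos_of_nonneg h (by linarith)
  have h3 := this.trans_le h2
  rw [div_neg_iff] at h3
  rcases h3 with h3 | h3 <;> linarith

lemma profileForce_pos_of_nonneg {n c s t : ℝ} (hn : 1 < n) (hs : 1 < s) (hst : s < t)
    (h : 0 ≤ profileForce n c t) : 0 < profileForce n c s := by
  by_contra hcon
  have := profileForce_lt_of_nonpos hn hs hst (not_lt.mp hcon)
  linarith

lemma profilePotential_pos {n m c s : ℝ} (hn : 1 < n) (hs : 1 < s)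
    (h : 0 ≤ profileForce n c s) : 0 < profilePotential n m c s := by
  refine intervalIntegral.intervalIntegral_pos_of_pos_on
    (intervalIntegrable_of_continuousOn_Ioi (continuousOn_profileDensity n m c) one_pos
      (by linarith)) (fun x hx => ?_) hs
  exact mul_pos (profileForce_pos_of_nonneg hn hx.1 hx.2 h)
    (Real.rpow_pos_of_pos (by linarith [hx.1]) _)

lemma profileForce_neg_of_potential_nonpos {n m c s : ℝ} (hn : 1 < n) (hs : 1 < s)
    (h : profilePotential n m c s ≤ 0) : profileForce n c s < 0 := by
  by_contra hcon
  have := profilePotential_pos (m := m) hn hs (not_lt.mp hcon)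
  linarith

/-- Where the potential is no longer positive the force is already negative, and it stays so; the
potential keeps decreasing. Hence there is at most one zero beyond 1, which is what identifies the
crest. -/
lemma profilePotential_neg {n m c s t : ℝ} (hn : 1 < n) (hs : 1 < s) (hst : s < t)
    (h : profilePotential n m c s ≤ 0) : profilePotential n m c t < 0 := by
  have hq := profileForce_neg_of_potential_nonpos hn hs h
  have hc := continuousOn_profileDensity n m c
  have e : profilePotential n m c t = profilePotential n m c s
      + ∫ r in s..t, profileForce n c r * r ^ (-n - m) :=
    (intervalIntegral.integral_add_adjacent_intervals
      (intervalIntegrable_of_continuousOn_Ioi hc one_pos (by linarith))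
      (intervalIntegrable_of_continuousOn_Ioi hc (by linarith) (by linarith))).symm
  have hneg : 0 < ∫ r in s..t, -(profileForce n c r * r ^ (-n - m)) := by
    refine intervalIntegral.intervalIntegral_pos_of_pos_on
      (intervalIntegrable_of_continuousOn_Ioi hc (by linarith) (by linarith)).neg
      (fun x hx => ?_) hst
    have hx1 := profileForce_lt_of_nonpos hn hs hx.1 hq.le
    have hx2 := Real.rpow_pos_of_pos (show 0 < x by linarith [hx.1]) (-n - m)
    nlinarith
  rw [intervalIntegral.integral_neg] at hneg
  linarith

lemma IsSolitaryWave.pos {n m c : ℝ} {ψ : ℝ → ℝ} (h : IsSolitaryWave n m c ψ) (y : ℝ) :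
    0 < ψ y := one_pos.trans (h.one_lt y)

lemma IsSolitaryWave.hasDerivAt {n m c : ℝ} {ψ : ℝ → ℝ} (h : IsSolitaryWave n m c ψ) (y : ℝ) :
    HasDerivAt ψ (deriv ψ y) y :=
  ((h.smooth.differentiable two_ne_zero) y).hasDerivAt

lemma IsSolitaryWave.contDiff_deriv {n m c : ℝ} {ψ : ℝ → ℝ} (h : IsSolitaryWave n m c ψ) :
    ContDiff ℝ 1 (deriv ψ) :=
  (contDiff_succ_iff_deriv.mp (show ContDiff ℝ (1 + 1) ψ by simpa [one_add_one_eq_two] using h.smooth)).2.2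

lemma IsSolitaryWave.contDiff_rpow_mul_deriv {n m c : ℝ} {ψ : ℝ → ℝ}
    (h : IsSolitaryWave n m c ψ) (e : ℝ) : ContDiff ℝ 1 (fun y => ψ y ^ e * deriv ψ y) :=
  ((h.smooth.of_le one_le_two).rpow_const_of_ne fun y => (h.pos y).ne').mul h.contDiff_deriv

lemma IsSolitaryWave.hasDerivAt_flux {n m c : ℝ} {ψ : ℝ → ℝ} (h : IsSolitaryWave n m c ψ)
    (hc : 0 < c) (y : ℝ) :
    HasDerivAt (fun z => ψ z ^ (-m) * deriv ψ z) (profileForce n c (ψ y) * ψ y ^ (-n) / c) y := by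
  have hd := ((h.contDiff_rpow_mul_deriv (-m)).differentiable one_ne_zero y).hasDerivAt
  have hp := h.profile y
  have hn0 := Real.rpow_pos_of_pos (h.pos y) n
  refine hd.congr_deriv (Eq.symm ?_)
  rw [Real.rpow_neg (h.pos y).le]
  unfold profileForce
  field_simp
  linarith

/-- The first integral: the energy of the profile equation vanishes along a solitary wave. -/
lemma IsSolitaryWave.first_integral {n m c : ℝ} {ψ : ℝ → ℝ} (h : IsSolitaryWave n m c ψ)
    (hc : 0 < c) (y : ℝ) :
    c / 2 * (ψ y ^ (-m) * deriv ψ y) ^ 2 = profilePotential n m c (ψ y) := by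
  set E : ℝ → ℝ := fun z => c / 2 * (ψ z ^ (-m) * deriv ψ z) ^ 2 - profilePotential n m c (ψ z)
    with hE
  have hder : ∀ z, HasDerivAt E 0 z := fun z => by
    have h1 := ((h.hasDerivAt_flux hc z).pow 2).const_mul (c / 2)
    have h2 := (hasDerivAt_profilePotential n m c (h.pos z)).comp z (h.hasDerivAt z)
    refine HasDerivAt.congr_deriv (h1.sub h2) ?_
    have e : ψ z ^ (-n - m) = ψ z ^ (-n) * ψ z ^ (-m) := by
      rw [← Real.rpow_add (h.pos z)]; ring_nf
    rw [e]
    field_simp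
    ring
  have hconst : ∀ x z, E x = E z := is_const_of_deriv_eq_zero
    (fun z => (hder z).differentiableAt) (fun z => (hder z).deriv)
  -- Decay of ψ' is not assumed, so the constant value of `E` is computed along mean value points ξ
  -- k, where ψ' tends to 0 because ψ has a limit.
  have hmv : ∀ k : ℕ, ∃ ξ ∈ Ioo (k : ℝ) (k + 1), deriv ψ ξ = ψ (k + 1) - ψ k := fun k => by
    obtain ⟨ξ, hξ, e⟩ := exists_deriv_eq_slope ψ (show (k : ℝ) < k + 1 by linarith)
      h.smooth.continuous.continuousOn (h.smooth.differentiable two_ne_zero).differentiableOn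
    exact ⟨ξ, hξ, by rw [e]; simp⟩
  choose ξ hξ hξd using hmv
  have hξt : Tendsto ξ atTop atTop :=
    tendsto_atTop_mono (fun k => (hξ k).1.le) tendsto_natCast_atTop_atTop
  have hψξ : Tendsto (fun k => ψ (ξ k)) atTop (𝓝 1) := h.tendsto_atTop.comp hξt
  have hdξ : Tendsto (fun k => deriv ψ (ξ k)) atTop (𝓝 0) := by
    simp_rw [hξd]
    have t1 : Tendsto (fun k : ℕ => ψ ((k : ℝ) + 1)) atTop (𝓝 1) :=
      h.tendsto_atTop.comp (tendsto_atTop_add_const_right _ _ tendsto_natCast_atTop_atTop)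
    have t2 : Tendsto (fun k : ℕ => ψ (k : ℝ)) atTop (𝓝 1) :=
      h.tendsto_atTop.comp tendsto_natCast_atTop_atTop
    simpa using t1.sub t2
  have hEξ : Tendsto (fun k => E (ξ k)) atTop (𝓝 0) := by
    have t1 : Tendsto (fun k => ψ (ξ k) ^ (-m)) atTop (𝓝 (1 ^ (-m))) :=
      hψξ.rpow_const (Or.inl one_ne_zero)
    have t2 : Tendsto (fun k => profilePotential n m c (ψ (ξ k))) atTop
        (𝓝 (profilePotential n m c 1)) :=
      ((hasDerivAt_profilePotential n m c one_pos).continuousAt.tendsto).comp hψξ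
    have := (((t1.mul hdξ).pow 2).const_mul (c / 2)).sub t2
    rw [profilePotential_one] at this
    simpa [hE] using this
  have hE0 : E y = 0 := by
    have : (fun k => E (ξ k)) = fun _ => E y := funext fun k => hconst _ _
    rw [this] at hEξ
    exact tendsto_nhds_unique tendsto_const_nhds hEξ
  simp only [hE] at hE0
  linarith

lemma IsSolitaryWave.deriv_zero {n m c : ℝ} {ψ : ℝ → ℝ} (h : IsSolitaryWave n m c ψ) :
    deriv ψ 0 = 0 := by
  have h1 : deriv (fun x => ψ (-x)) 0 = -deriv ψ (-0) := deriv_comp_neg ψ 0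
  have h2 : (fun x => ψ (-x)) = ψ := funext h.even
  rw [h2, neg_zero] at h1
  linarith

lemma IsSolitaryWave.potential_nonneg {n m c : ℝ} {ψ : ℝ → ℝ} (h : IsSolitaryWave n m c ψ)
    (hc : 0 < c) (y : ℝ) : 0 ≤ profilePotential n m c (ψ y) := by
  rw [← h.first_integral hc y]
  positivity

lemma IsSolitaryWave.potential_crest {n m c : ℝ} {ψ : ℝ → ℝ} (h : IsSolitaryWave n m c ψ)
    (hc : 0 < c) : profilePotential n m c (ψ 0) = 0 := by
  rw [← h.first_integral hc 0, h.deriv_zero]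
  ring

/-- By the first integral the potential is nonnegative along the wave; it vanishes at ψ 0 and is
negative above that height. -/
lemma IsSolitaryWave.le_crest {n m c : ℝ} {ψ : ℝ → ℝ} (h : IsSolitaryWave n m c ψ)
    (hn : 1 < n) (hc : 0 < c) (y : ℝ) : ψ y ≤ ψ 0 := by
  by_contra hlt
  have := profilePotential_neg hn (h.one_lt 0) (not_le.mp hlt) (h.potential_crest hc).le
  linarith [h.potential_nonneg hc y]

lemma IsSolitaryWave.eq_crest_of_deriv_eq_zero {n m c : ℝ} {ψ : ℝ → ℝ}
    (h : IsSolitaryWave n m c ψ) (hn : 1 < n) (hc : 0 < c) {y : ℝ} (hy : deriv ψ y = 0) :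
    ψ y = ψ 0 := by
  refine le_antisymm (h.le_crest hn hc y) ?_
  by_contra hlt
  have h0 : profilePotential n m c (ψ y) = 0 := by
    rw [← h.first_integral hc y, hy]
    ring
  have := profilePotential_neg hn (h.one_lt y) (not_le.mp hlt) h0.le
  linarith [h.potential_crest hc]

/-- A second critical point y would have crest height. Rolle applied to the flux on [0, y] gives a
point where the force vanishes; the force is negative at the crest, so ψ dips strictly below it in
between. The minimum over [0, y] is then a critical point below the crest, which is impossible. -/
lemma IsSolitaryWave.deriv_ne_zero {n m c : ℝ} {ψ : ℝ → ℝ} (h : IsSolitaryWave n m c ψ)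
    (hn : 1 < n) (hc : 0 < c) {y : ℝ} (hy : 0 < y) : deriv ψ y ≠ 0 := by
  intro h0
  obtain ⟨ξ, hξ, e⟩ := exists_hasDerivAt_eq_zero (f := fun z => ψ z ^ (-m) * deriv ψ z) hy
    (h.contDiff_rpow_mul_deriv (-m)).continuous.continuousOn
    (by simp [h0, h.deriv_zero]) (fun x _ => h.hasDerivAt_flux hc x)
  have hq : profileForce n c (ψ ξ) = 0 := by
    have := Real.rpow_pos_of_pos (h.pos ξ) (-n)
    simpa [hc.ne', this.ne'] using e
  have hlt : ψ ξ < ψ 0 := by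
    refine lt_of_le_of_ne (h.le_crest hn hc ξ) fun heq => ?_
    have := profileForce_neg_of_potential_nonpos hn (h.one_lt 0) (h.potential_crest hc).le
    rw [← heq, hq] at this
    exact lt_irrefl _ this
  obtain ⟨x, hx, hmin⟩ := isCompact_Icc.exists_isMinOn (nonempty_Icc.mpr hy.le)
    (h.smooth.continuous.continuousOn (s := Icc 0 y))
  have hxlt : ψ x < ψ 0 := (hmin (Ioo_subset_Icc_self hξ)).trans_lt hlt
  have hy0 := h.eq_crest_of_deriv_eq_zero hn hc h0
  have hx0 : x ≠ 0 := fun e => by rw [e] at hxlt; exact lt_irrefl _ hxlt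
  have hxy : x ≠ y := fun e => by rw [e, hy0] at hxlt; exact lt_irrefl _ hxlt
  have hloc : IsLocalMin ψ x := hmin.isLocalMin
    (Icc_mem_nhds (lt_of_le_of_ne hx.1 hx0.symm) (lt_of_le_of_ne hx.2 hxy))
  rw [h.eq_crest_of_deriv_eq_zero hn hc hloc.deriv_eq_zero] at hxlt
  exact lt_irrefl _ hxlt

lemma IsSolitaryWave.deriv_neg {n m c : ℝ} {ψ : ℝ → ℝ} (h : IsSolitaryWave n m c ψ)
    (hn : 1 < n) (hc : 0 < c) {y : ℝ} (hy : 0 < y) : deriv ψ y < 0 := by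
  rcases hasDerivWithinAt_forall_lt_or_forall_gt_of_forall_ne (convex_Ioi (0 : ℝ))
    (fun x _ => (h.hasDerivAt x).hasDerivWithinAt)
    (fun x hx => h.deriv_ne_zero hn hc hx) with hneg | hpos
  · exact hneg y hy
  · have hmono : StrictMonoOn ψ (Ici 0) := strictMonoOn_of_deriv_pos (convex_Ici 0)
      h.smooth.continuous.continuousOn (fun x hx => hpos x (by simpa using hx))
    have := hmono (by simp) (show (1 : ℝ) ∈ Ici 0 by simp) one_pos
    linarith [h.le_crest hn hc 1]

lemma IsSolitaryWave.antitoneOn {n m c : ℝ} {ψ : ℝ → ℝ} (h : IsSolitaryWave n m c ψ)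
    (hn : 1 < n) (hc : 0 < c) : AntitoneOn ψ (Ici 0) :=
  antitoneOn_of_deriv_nonpos (convex_Ici 0) h.smooth.continuous.continuousOn
    (h.smooth.differentiable two_ne_zero).differentiableOn
    (fun x hx => (h.deriv_neg hn hc (by simpa using hx)).le)

lemma IsSolitaryWave.deriv_nonpos {n m c : ℝ} {ψ : ℝ → ℝ} (h : IsSolitaryWave n m c ψ)
    (hn : 1 < n) (hc : 0 < c) {y : ℝ} (hy : 0 ≤ y) : deriv ψ y ≤ 0 := by
  rcases hy.eq_or_lt with rfl | hy
  · exact h.deriv_zero.le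
  · exact (h.deriv_neg hn hc hy).le

/-! ### Decay of solitary waves, uniformly in the speed -/

lemma rpow_le_rpow_abs {s S : ℝ} (e : ℝ) (hs : 1 ≤ s) (hS : s ≤ S) : s ^ e ≤ S ^ |e| :=
  (Real.rpow_le_rpow_of_exponent_le hs (le_abs_self e)).trans
    (Real.rpow_le_rpow (by linarith) hS (abs_nonneg e))

lemma inv_rpow_abs_le_rpow {s S : ℝ} (e : ℝ) (hs : 1 ≤ s) (hS : s ≤ S) :
    (S ^ |e|)⁻¹ ≤ s ^ e := by
  have h := rpow_le_rpow_abs (-e) hs hS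
  rw [abs_neg, Real.rpow_neg (by linarith)] at h
  exact inv_le_of_inv_le₀ (Real.rpow_pos_of_pos (by linarith) _) h

/-- Being affine in c, the potential is jointly continuous in (c, s) as soon as it is continuous in
s. -/
lemma profilePotential_affine (n m c : ℝ) {s : ℝ} (hs : 0 < s) :
    profilePotential n m c s = profilePotential n m 0 s
      + c * (profilePotential n m 1 s - profilePotential n m 0 s) := by
  have hi : ∀ k, IntervalIntegrable (fun r => profileForce n k r * r ^ (-n - m)) volume 1 s :=
    fun k => intervalIntegrable_of_continuousOn_Ioi (continuousOn_profileDensity n m k) one_pos hs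
  unfold profilePotential
  rw [← intervalIntegral.integral_sub (hi 1) (hi 0), ← intervalIntegral.integral_const_mul,
    ← intervalIntegral.integral_add (hi 0) (((hi 1).sub (hi 0)).const_mul c)]
  refine intervalIntegral.integral_congr fun r _ => ?_
  simp only [profileForce]
  ring

lemma continuousOn_profilePotential (n m c : ℝ) :
    ContinuousOn (profilePotential n m c) (Ioi 0) := fun _ hs =>
  (hasDerivAt_profilePotential n m c hs).continuousAt.continuousWithinAt

/-- One unit above the crest of a wave of speed c₀ the potential is negative, and remains so for
nearby speeds. A crest beyond that height would contradict the vanishing of the potential at crests.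
-/
lemma exists_uniform_bound {n m c₀ : ℝ} (hn : 1 < n) (hc₀ : n < c₀)
    (hwave : HasSolitaryWave n m c₀) :
    ∃ S : ℝ, 1 < S ∧ ∀ᶠ c in 𝓝 c₀, ∀ ψ, IsSolitaryWave n m c ψ → ∀ y, ψ y ≤ S := by
  obtain ⟨ψ₀, h₀⟩ := hwave
  have hS1 := h₀.one_lt 0
  refine ⟨ψ₀ 0 + 1, by linarith, ?_⟩
  have hneg : profilePotential n m c₀ (ψ₀ 0 + 1) < 0 :=
    profilePotential_neg hn hS1 (by linarith) (h₀.potential_crest (by linarith)).le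
  have hcont : Continuous fun c => profilePotential n m c (ψ₀ 0 + 1) := by
    rw [show (fun c => profilePotential n m c (ψ₀ 0 + 1)) = _ from
      funext fun c => profilePotential_affine n m c (show 0 < ψ₀ 0 + 1 by linarith)]
    fun_prop
  filter_upwards [hcont.continuousAt.eventually_lt continuousAt_const hneg,
    lt_mem_nhds (show 0 < c₀ by linarith)] with c hc hcpos ψ hψ y
  refine (hψ.le_crest hn hcpos y).trans ?_
  by_contra hlt
  have := profilePotential_neg hn (by linarith) (not_le.mp hlt) hc.le
  rw [hψ.potential_crest hcpos] at this
  exact lt_irrefl _ this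

/-- Bernoulli's inequality at s⁻¹ gives s^n - 1 ≤ n s^(n-1) (s - 1). -/
lemma le_profileForce {n c s : ℝ} (hn : 1 < n) (hs : 1 ≤ s) :
    (c - n * s ^ (n - 1)) * (s - 1) ≤ profileForce n c s := by
  have hs0 : 0 < s := by linarith
  have h := one_add_mul_self_le_rpow_one_add (s := s⁻¹ - 1) (by linarith [inv_pos.mpr hs0]) hn.le
  have e : (1 + (s⁻¹ - 1)) ^ n = (s ^ n)⁻¹ := by
    rw [add_sub_cancel, Real.inv_rpow hs0.le]
  rw [e] at h
  have hp := Real.rpow_pos_of_pos hs0 n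
  have h2 := mul_le_mul_of_nonneg_left h hp.le
  rw [mul_inv_cancel₀ hp.ne'] at h2
  have e2 : s ^ (n - 1) = s ^ n * s⁻¹ := by rw [Real.rpow_sub_one hs0.ne', div_eq_mul_inv]
  have e3 : s ^ (n - 1) * s = s ^ n := by rw [e2]; field_simp
  unfold profileForce
  rw [← e3] at h2 ⊢
  have e4 : s ^ (n - 1) * s * (1 + n * (s⁻¹ - 1)) = s ^ (n - 1) * (s + n * (1 - s)) := by
    field_simp
  rw [e4] at h2
  linarith

lemma profileForce_le {n c s : ℝ} (hn : 1 < n) (hs : 1 ≤ s) :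
    profileForce n c s ≤ c * (s - 1) := by
  have := Real.one_le_rpow hs (by linarith : 0 ≤ n)
  unfold profileForce
  linarith

/-- By the first integral the right-hand side is ψ'² at s = ψ, so this says |ψ'| ≥ (γ(c₀)/2)(ψ - 1).
The linearized rate is γ(c); giving up a factor 2 leaves room for c and s to vary near (c₀, 1). -/
lemma exists_potential_lower_bound {n m c₀ : ℝ} (hn : 1 < n) (hc₀ : n < c₀) :
    ∃ δ : ℝ, 0 < δ ∧ ∀ᶠ c in 𝓝 c₀, ∀ s, 1 ≤ s → s < 1 + δ →
      (gam n c₀ / 2) ^ 2 * (s - 1) ^ 2 ≤ 2 / c * (s ^ m) ^ 2 * profilePotential n m c s := by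
  have hc0 : 0 < c₀ := by linarith
  have hlam : 0 < c₀ - n := by linarith
  have hgam : gam n c₀ ^ 2 = (c₀ - n) / c₀ := Real.sq_sqrt (by positivity)
  have h1 : ContinuousAt (fun p : ℝ × ℝ => (p.1 - n * p.2 ^ (n - 1)) * p.2 ^ (-n - m)) (c₀, 1) := by
    refine ContinuousAt.mul (ContinuousAt.sub continuousAt_fst
      (continuousAt_const.mul ?_)) ?_ <;>
    exact continuousAt_snd.rpow_const (Or.inl one_ne_zero)
  have h2 : ContinuousAt (fun p : ℝ × ℝ => (p.2 ^ m) ^ 2 * c₀ * 2) (c₀, 1) :=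
    ((((continuousAt_snd.rpow_const (Or.inl one_ne_zero))).pow 2).mul continuousAt_const).mul
      continuousAt_const
  have e1 := h1.eventually (lt_mem_nhds (show (c₀ - n) / 2 < (c₀ - n * 1 ^ (n - 1)) * 1 ^ (-n - m) by
    simp only [Real.one_rpow]; linarith))
  have e2 := continuousAt_fst.eventually_lt h2 (show c₀ < (1 ^ m) ^ 2 * c₀ * 2 by
    simp only [Real.one_rpow]; linarith)
  rw [nhds_prod_eq] at e1 e2
  obtain ⟨pa, hpa, pb, hpb, hp⟩ := eventually_prod_iff.mp (e1.and e2)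
  obtain ⟨δ, hδ, hball⟩ := Metric.eventually_nhds_iff.mp hpb
  refine ⟨δ, hδ, ?_⟩
  filter_upwards [hpa, lt_mem_nhds hc0] with c hc hcpos s hs1 hs2
  have hin : ∀ r, 1 ≤ r → r ≤ s → dist r 1 < δ := fun r hr1 hr2 => by
    rw [Real.dist_eq, abs_of_nonneg (by linarith)]
    linarith
  have hP : (c₀ - n) / 4 * (s - 1) ^ 2 ≤ profilePotential n m c s := by
    have hint : ∫ r in (1 : ℝ)..s, (c₀ - n) / 2 * (r - 1) = (c₀ - n) / 4 * (s - 1) ^ 2 := by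
      rw [intervalIntegral.integral_const_mul, intervalIntegral.integral_sub (by simp) (by simp)]
      simp only [integral_id, intervalIntegral.integral_const, smul_eq_mul]
      ring
    rw [← hint]
    refine intervalIntegral.integral_mono_on hs1
      ((by fun_prop : Continuous fun r : ℝ => (c₀ - n) / 2 * (r - 1)).intervalIntegrable _ _)
      (intervalIntegrable_of_continuousOn_Ioi (continuousOn_profileDensity n m c) one_pos
        (by linarith)) fun r hr => ?_
    have hk := (hp hc (hball (hin r hr.1 hr.2))).1
    simp only at hk
    have hr0 := Real.rpow_pos_of_pos (show 0 < r by linarith [hr.1]) (-n - m)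
    calc (c₀ - n) / 2 * (r - 1) ≤ (c - n * r ^ (n - 1)) * r ^ (-n - m) * (r - 1) :=
          mul_le_mul_of_nonneg_right hk.le (by linarith [hr.1])
      _ = (c - n * r ^ (n - 1)) * (r - 1) * r ^ (-n - m) := by ring
      _ ≤ _ := mul_le_mul_of_nonneg_right (le_profileForce hn hr.1) hr0.le
  have hk := (hp hc (hball (hin s hs1 le_rfl))).2
  simp only at hk
  have h3 : 1 / c₀ ≤ 2 / c * (s ^ m) ^ 2 := by
    rw [div_mul_eq_mul_div, div_le_div_iff₀ hc0 hcpos]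
    linarith
  calc (gam n c₀ / 2) ^ 2 * (s - 1) ^ 2 = 1 / c₀ * ((c₀ - n) / 4 * (s - 1) ^ 2) := by
        rw [div_pow, hgam]; ring
    _ ≤ 2 / c * (s ^ m) ^ 2 * profilePotential n m c s :=
        mul_le_mul h3 hP (by positivity) (by positivity)

/-- Beyond 1 a nonnegative force makes the potential positive, so max(P, -force) is positive; by
continuity it has a positive minimum on the compact box. -/
lemma exists_potential_or_force {n : ℝ} (m : ℝ) (hn : 1 < n) (c₁ c₂ S : ℝ) {δ : ℝ} (hδ : 0 < δ) :
    ∃ p : ℝ, 0 < p ∧ ∀ c ∈ Icc c₁ c₂, ∀ s ∈ Icc (1 + δ) S,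
      p ≤ profilePotential n m c s ∨ p ≤ -profileForce n c s := by
  rcases (Icc c₁ c₂ ×ˢ Icc (1 + δ) S).eq_empty_or_nonempty with hem | hne
  · refine ⟨1, one_pos, fun c hc s hs => ?_⟩
    exact absurd (show (c, s) ∈ Icc c₁ c₂ ×ˢ Icc (1 + δ) S from ⟨hc, hs⟩) (by simp [hem])
  have hmaps : MapsTo Prod.snd (Icc c₁ c₂ ×ˢ Icc (1 + δ) S) (Ioi (0 : ℝ)) := fun x hx => by
    have := hx.2.1
    simp only [mem_Ioi]
    linarith
  have hcont : ContinuousOn (fun x : ℝ × ℝ => max (profilePotential n m 0 x.2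
      + x.1 * (profilePotential n m 1 x.2 - profilePotential n m 0 x.2))
      (-(x.1 * (x.2 - 1) - (x.2 ^ n - 1)))) (Icc c₁ c₂ ×ˢ Icc (1 + δ) S) := by
    have hP : ∀ k, ContinuousOn (fun x : ℝ × ℝ => profilePotential n m k x.2)
        (Icc c₁ c₂ ×ˢ Icc (1 + δ) S) := fun k =>
      (continuousOn_profilePotential n m k).comp continuousOn_snd hmaps
    have hr : ContinuousOn (fun x : ℝ × ℝ => x.2 ^ n) (Icc c₁ c₂ ×ˢ Icc (1 + δ) S) :=
      continuousOn_snd.rpow_const fun x hx => Or.inl (ne_of_gt (hmaps hx))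
    refine ContinuousOn.sup ((hP 0).add (continuousOn_fst.mul ((hP 1).sub (hP 0)))) ?_
    exact ((continuousOn_fst.mul (continuousOn_snd.sub continuousOn_const)).sub
      (hr.sub continuousOn_const)).neg
  obtain ⟨x, hx, hmin⟩ := (isCompact_Icc.prod isCompact_Icc).exists_isMinOn hne hcont
  have hx1 : 1 < x.2 := by linarith [hx.2.1]
  rw [isMinOn_iff] at hmin
  simp only [← profilePotential_affine n m x.1 (show 0 < x.2 by linarith)] at hmin
  refine ⟨max (profilePotential n m x.1 x.2) (-profileForce n x.1 x.2), ?_, fun c hc s hs => ?_⟩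
  · rw [lt_max_iff]
    rcases le_or_gt 0 (profileForce n x.1 x.2) with h | h
    · exact Or.inl (profilePotential_pos hn hx1 h)
    · exact Or.inr (neg_pos.mpr h)
  · have := hmin (c, s) ⟨hc, hs⟩
    rw [← profilePotential_affine n m c (show 0 < s by linarith [hs.1])] at this
    exact le_max_iff.mp this

/-- While the wave stays above 1 + δ, its flux at y ≥ 1 is at most -k. Either the potential is large
there and the first integral gives it, or the force is at most -p at y and, by concavity, on all of
[0, y], so the flux has dropped from 0 at rate at least k. Hence ψ falls at a definite rate and
cannot remain in (1, S] for long. -/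
lemma exists_uniform_entrance {n m c₁ c₂ S δ : ℝ} (hn : 1 < n) (hc₁ : 0 < c₁) (hc₁₂ : c₁ ≤ c₂)
    (hS : 1 < S) (hδ : 0 < δ) :
    ∃ L : ℝ, 0 < L ∧ ∀ c ∈ Icc c₁ c₂, ∀ ψ, IsSolitaryWave n m c ψ → (∀ y, ψ y ≤ S) →
      ∀ y, L ≤ y → ψ y < 1 + δ := by
  obtain ⟨p, hp, hpq⟩ := exists_potential_or_force m hn c₁ c₂ S hδ
  have hc₂ : 0 < c₂ := by linarith
  have hS0 : 0 < S := by linarith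
  set k : ℝ := min (Real.sqrt (2 * p / c₂)) (p * (S ^ |-n|)⁻¹ / c₂) with hk
  have hSn := Real.rpow_pos_of_pos hS0 |-n|
  have hSm := Real.rpow_pos_of_pos hS0 |m|
  have hkpos : 0 < k := lt_min (Real.sqrt_pos.mpr (by positivity)) (by positivity)
  -- The flux bound is available only from y = 1, hence the extra length. From here on `L` is the
  -- point beyond this threshold at which the bound is to be proved.
  refine ⟨2 + S / (k * (S ^ |m|)⁻¹), by positivity, fun c hc ψ h hψS L hL => ?_⟩
  have hcpos : 0 < c := hc₁.trans_le hc.1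
  by_contra hcon
  have hcon := not_lt.mp hcon
  have hL2 : 2 ≤ L := by
    have : 0 < S / (k * (S ^ |m|)⁻¹) := by positivity
    linarith
  have hrange : ∀ y ∈ Icc 0 L, ψ y ∈ Icc (1 + δ) S := fun y hy =>
    ⟨hcon.trans (h.antitoneOn hn hcpos hy.1 (by simp; linarith) hy.2), hψS y⟩
  set u : ℝ → ℝ := fun z => ψ z ^ (-m) * deriv ψ z with hu
  have hder := h.hasDerivAt_flux hcpos
  have hunonpos : ∀ y, 0 ≤ y → u y ≤ 0 := fun y hy =>
    mul_nonpos_of_nonneg_of_nonpos (Real.rpow_pos_of_pos (h.pos y) _).le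
      (h.deriv_nonpos hn hcpos hy)
  have hu0 : u 0 = 0 := by simp [hu, h.deriv_zero]
  have hcase : ∀ y ∈ Icc 1 L, u y ≤ -k := fun y hy => by
    have hy0 : 0 ≤ y := by linarith [hy.1]
    rcases hpq c hc (ψ y) (hrange y ⟨hy0, hy.2⟩) with hP | hq
    · rw [← h.first_integral hcpos y] at hP
      have h1 : 2 * p / c₂ ≤ u y ^ 2 := by
        rw [div_le_iff₀ hc₂]
        have := mul_le_mul_of_nonneg_right hc.2 (sq_nonneg (u y))
        simp only [hu] at this ⊢
        linarith
      have h2 := Real.sqrt_le_sqrt h1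
      rw [Real.sqrt_sq_eq_abs, abs_of_nonpos (hunonpos y hy0)] at h2
      have := min_le_left (Real.sqrt (2 * p / c₂)) (p * (S ^ |-n|)⁻¹ / c₂)
      linarith
    · have hall : ∀ z ∈ Icc 0 y, profileForce n c (ψ z) ≤ -p := fun z hz => by
        rcases (h.antitoneOn hn hcpos hz.1 (show y ∈ Ici 0 from hy0) hz.2).eq_or_lt with e | e
        · rw [← e]; linarith
        · have := profileForce_lt_of_nonpos hn (h.one_lt y) e (by linarith)
          linarith
      have hslope : ∀ z ∈ Icc 0 y, profileForce n c (ψ z) * ψ z ^ (-n) / c ≤ -k := fun z hz => by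
        have hz1 := inv_rpow_abs_le_rpow (-n) (h.one_lt z).le (hψS z)
        have hz2 : p * (S ^ |-n|)⁻¹ ≤ -profileForce n c (ψ z) * ψ z ^ (-n) :=
          mul_le_mul (by linarith [hall z hz]) hz1 (by positivity) (by linarith [hall z hz])
        have hz3 : p * (S ^ |-n|)⁻¹ / c₂ ≤ -profileForce n c (ψ z) * ψ z ^ (-n) / c :=
          div_le_div₀ (by have : 0 < p * (S ^ |-n|)⁻¹ := by positivity
                          linarith) hz2 hcpos hc.2
        have := min_le_right (Real.sqrt (2 * p / c₂)) (p * (S ^ |-n|)⁻¹ / c₂)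
        rw [neg_mul, neg_div] at hz3
        linarith
      have hmv := (convex_Icc 0 y).image_sub_le_mul_sub_of_deriv_le (f := u) (C := -k)
        (fun z _ => (hder z).continuousAt.continuousWithinAt)
        (fun z _ => (hder z).differentiableAt.differentiableWithinAt)
        (fun z hz => by
          rw [(hder z).deriv]
          exact hslope z (interior_subset hz)) 0 ⟨le_rfl, hy0⟩ y ⟨hy0, le_rfl⟩ hy0
      rw [hu0] at hmv
      nlinarith [hy.1]
  have hmv := (convex_Icc 1 L).image_sub_le_mul_sub_of_deriv_le (f := ψ) (C := -(k * (S ^ |m|)⁻¹))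
    h.smooth.continuous.continuousOn
    (h.smooth.differentiable two_ne_zero).differentiableOn
    (fun z hz => by
      have hz := interior_subset hz
      have e : deriv ψ z = ψ z ^ m * u z := by
        simp only [hu]
        rw [← mul_assoc, ← Real.rpow_add (h.pos z), add_neg_cancel, Real.rpow_zero, one_mul]
      rw [e]
      have h1 := hcase z hz
      have h2 := inv_rpow_abs_le_rpow m (h.one_lt z).le (hψS z)
      have h3 : k * (S ^ |m|)⁻¹ ≤ -u z * ψ z ^ m :=
        mul_le_mul (by linarith) h2 (by positivity) (by linarith)
      linarith)
    1 ⟨le_rfl, by linarith⟩ L ⟨by linarith, le_rfl⟩ (by linarith)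
  have h4 : S / (k * (S ^ |m|)⁻¹) * (k * (S ^ |m|)⁻¹) = S := by
    field_simp
  have h5 : 0 < k * (S ^ |m|)⁻¹ := by positivity
  have h6 := hψS 1
  have h7 : (S / (k * (S ^ |m|)⁻¹)) * (k * (S ^ |m|)⁻¹) ≤ (L - 1) * (k * (S ^ |m|)⁻¹) :=
    mul_le_mul_of_nonneg_right (by linarith) h5.le
  linarith [h.one_lt L]

lemma profilePotential_le {n m c s S : ℝ} (hn : 1 < n) (hc : 0 < c) (hs : 1 ≤ s) (hS : s ≤ S) :
    profilePotential n m c s ≤ c * S ^ |-n - m| * (s - 1) ^ 2 := by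
  have h : profilePotential n m c s ≤ ∫ _ in (1 : ℝ)..s, c * S ^ |-n - m| * (s - 1) := by
    refine intervalIntegral.integral_mono_on hs
      (intervalIntegrable_of_continuousOn_Ioi (continuousOn_profileDensity n m c) one_pos
        (by linarith)) (continuous_const.intervalIntegrable _ _) fun r hr => ?_
    have h1 := profileForce_le (c := c) hn hr.1
    have h2 := rpow_le_rpow_abs (-n - m) hr.1 (hr.2.trans hS)
    have h3 := Real.rpow_pos_of_pos (show 0 < r by linarith [hr.1]) (-n - m)
    calc profileForce n c r * r ^ (-n - m) ≤ c * (s - 1) * r ^ (-n - m) :=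
          mul_le_mul_of_nonneg_right
            (h1.trans (mul_le_mul_of_nonneg_left (by linarith [hr.2]) hc.le)) h3.le
      _ ≤ c * (s - 1) * S ^ |-n - m| :=
          mul_le_mul_of_nonneg_left h2 (mul_nonneg hc.le (by linarith))
      _ = _ := by ring
  refine h.trans (le_of_eq ?_)
  simp only [intervalIntegral.integral_const, smul_eq_mul]
  ring

lemma IsSolitaryWave.abs_flux_le {n m c S : ℝ} {ψ : ℝ → ℝ} (h : IsSolitaryWave n m c ψ)
    (hn : 1 < n) (hc : 0 < c) (hS : ∀ y, ψ y ≤ S) (y : ℝ) :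
    |ψ y ^ (-m) * deriv ψ y| ≤ Real.sqrt (2 * S ^ |-n - m|) * (ψ y - 1) := by
  have h1 := h.first_integral hc y
  have h2 := profilePotential_le (m := m) hn hc (h.one_lt y).le (hS y)
  have h3 : (ψ y ^ (-m) * deriv ψ y) ^ 2 ≤ 2 * S ^ |-n - m| * (ψ y - 1) ^ 2 := by
    rw [← h1] at h2
    nlinarith
  have h4 := Real.sqrt_le_sqrt h3
  rwa [Real.sqrt_sq_eq_abs, Real.sqrt_mul' _ (sq_nonneg _),
    Real.sqrt_sq (by linarith [h.one_lt y])] at h4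

/-- The potential is O((s - 1)²), so the first integral controls ψ' by ψ - 1; the force is O(s - 1),
so the profile equation controls the second derivative. Only the decay of ψ - 1 is then left to
prove. -/
lemma exists_bounds_by_excess {n c₁ S : ℝ} (m : ℝ) (hn : 1 < n) (hc₁ : 0 < c₁) (hS : 1 < S) :
    ∃ M : ℝ, 1 ≤ M ∧ ∀ c, c₁ ≤ c → ∀ ψ, IsSolitaryWave n m c ψ → (∀ y, ψ y ≤ S) → ∀ y,
      |deriv ψ y| ≤ M * (ψ y - 1) ∧ |ψ y ^ (-2 * m) * deriv ψ y| ≤ M * (ψ y - 1) ∧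
      |deriv (fun z => ψ z ^ (-2 * m) * deriv ψ z) y| ≤ M * (ψ y - 1) := by
  have hS0 : 0 < S := by linarith
  set R : ℝ := Real.sqrt (2 * S ^ |-n - m|) with hR
  have hR0 : 0 ≤ R := Real.sqrt_nonneg _
  set A : ℝ := S ^ |m| with hA
  set B : ℝ := |m| * S ^ |-m - 1| * (A * R) * (R * S) + A * ((1 + n * S ^ |n - 1| / c₁) * S ^ |-n|)
    with hB
  have hA0 : 0 < A := Real.rpow_pos_of_pos hS0 _
  have hB0 : 0 ≤ B := by positivity
  refine ⟨1 + A * R + B, by nlinarith [mul_nonneg hA0.le hR0], fun c hc ψ h hψ y => ?_⟩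
  have hcpos : 0 < c := hc₁.trans_le hc
  have hx : 0 < ψ y - 1 := by linarith [h.one_lt y]
  have hu := h.abs_flux_le hn hcpos hψ y
  rw [← hR] at hu
  have e1 : ψ y ^ m ≤ A := rpow_le_rpow_abs m (h.one_lt y).le (hψ y)
  have e2 : ψ y ^ (-m) ≤ A := by
    simpa [hA] using rpow_le_rpow_abs (-m) (h.one_lt y).le (hψ y)
  have p1 := Real.rpow_pos_of_pos (h.pos y) m
  have p2 := Real.rpow_pos_of_pos (h.pos y) (-m)
  have hd : |deriv ψ y| ≤ A * R * (ψ y - 1) := by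
    have e : deriv ψ y = ψ y ^ m * (ψ y ^ (-m) * deriv ψ y) := by
      rw [← mul_assoc, ← Real.rpow_add (h.pos y), add_neg_cancel, Real.rpow_zero, one_mul]
    rw [e, abs_mul, abs_of_pos p1, mul_assoc]
    exact mul_le_mul e1 hu (abs_nonneg _) hA0.le
  have hsplit : ∀ z, ψ z ^ (-2 * m) * deriv ψ z = ψ z ^ (-m) * (ψ z ^ (-m) * deriv ψ z) :=
    fun z => by rw [← mul_assoc, ← Real.rpow_add (h.pos z)]; ring_nf
  have hF : |ψ y ^ (-2 * m) * deriv ψ y| ≤ A * R * (ψ y - 1) := by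
    rw [hsplit, abs_mul, abs_of_pos p2, mul_assoc]
    exact mul_le_mul e2 hu (abs_nonneg _) hA0.le
  have hdF : deriv (fun z => ψ z ^ (-2 * m) * deriv ψ z) y
      = deriv ψ y * (-m) * ψ y ^ (-m - 1) * (ψ y ^ (-m) * deriv ψ y)
        + ψ y ^ (-m) * (profileForce n c (ψ y) * ψ y ^ (-n) / c) := by
    simp_rw [hsplit]
    exact (((h.hasDerivAt y).rpow_const (Or.inl (h.pos y).ne')).mul
      (h.hasDerivAt_flux hcpos y)).deriv
  have hq : |profileForce n c (ψ y)| / c ≤ (1 + n * S ^ |n - 1| / c₁) * (ψ y - 1) := by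
    have q1 := profileForce_le (c := c) hn (h.one_lt y).le
    have q2 := le_profileForce (c := c) hn (h.one_lt y).le
    have q3 := rpow_le_rpow_abs (n - 1) (h.one_lt y).le (hψ y)
    have q4 : n * ψ y ^ (n - 1) * (ψ y - 1) ≤ n * S ^ |n - 1| * (ψ y - 1) := by gcongr
    have q5 : 0 ≤ n * S ^ |n - 1| * (ψ y - 1) := by positivity
    have q6 : 0 < c * (ψ y - 1) := by positivity
    have q7 : |profileForce n c (ψ y)| ≤ c * (ψ y - 1) + n * S ^ |n - 1| * (ψ y - 1) := by
      rw [abs_le]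
      constructor <;> linarith
    calc |profileForce n c (ψ y)| / c
        ≤ (c * (ψ y - 1) + n * S ^ |n - 1| * (ψ y - 1)) / c := by gcongr
      _ = (1 + n * S ^ |n - 1| / c) * (ψ y - 1) := by field_simp
      _ ≤ (1 + n * S ^ |n - 1| / c₁) * (ψ y - 1) := by gcongr
  have hdFle : |deriv (fun z => ψ z ^ (-2 * m) * deriv ψ z) y| ≤ B * (ψ y - 1) := by
    rw [hdF]
    refine (abs_add_le _ _).trans ?_
    have r1 := rpow_le_rpow_abs (-m - 1) (h.one_lt y).le (hψ y)
    have r2 := rpow_le_rpow_abs (-n) (h.one_lt y).le (hψ y)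
    have s1 := Real.rpow_pos_of_pos (h.pos y) (-m - 1)
    have s2 := Real.rpow_pos_of_pos (h.pos y) (-n)
    have t1 : |deriv ψ y * (-m) * ψ y ^ (-m - 1) * (ψ y ^ (-m) * deriv ψ y)|
        ≤ |m| * S ^ |-m - 1| * (A * R) * (R * S) * (ψ y - 1) := by
      rw [abs_mul, abs_mul, abs_mul, abs_neg, abs_of_pos s1]
      have hu' : |ψ y ^ (-m) * deriv ψ y| ≤ R * S :=
        hu.trans (mul_le_mul_of_nonneg_left (by linarith [hψ y]) hR0)
      calc |deriv ψ y| * |m| * ψ y ^ (-m - 1) * |ψ y ^ (-m) * deriv ψ y|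
          ≤ (A * R * (ψ y - 1)) * |m| * S ^ |-m - 1| * (R * S) := by gcongr
        _ = _ := by ring
    have t2 : |ψ y ^ (-m) * (profileForce n c (ψ y) * ψ y ^ (-n) / c)|
        ≤ A * ((1 + n * S ^ |n - 1| / c₁) * S ^ |-n|) * (ψ y - 1) := by
      rw [mul_div_right_comm, abs_mul, abs_mul, abs_div, abs_of_pos p2, abs_of_pos s2,
        abs_of_pos hcpos]
      calc ψ y ^ (-m) * (|profileForce n c (ψ y)| / c * ψ y ^ (-n))
          ≤ A * ((1 + n * S ^ |n - 1| / c₁) * (ψ y - 1) * S ^ |-n|) := by gcongr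
        _ = _ := by ring
    rw [hB, add_mul]
    exact add_le_add t1 t2
  have w1 : 0 ≤ A * R * (ψ y - 1) := by positivity
  have w2 : 0 ≤ B * (ψ y - 1) := by positivity
  refine ⟨?_, ?_, ?_⟩ <;> nlinarith

/-- A profile above the reference state, bounded by `S`, whose excess and derivatives decay like
`C e^{-b|y|}`. -/
structure IsLocalizedProfile (m b C S : ℝ) (ψ : ℝ → ℝ) : Prop where
  smooth : ContDiff ℝ 2 ψ
  one_lt : ∀ y, 1 < ψ y
  le : ∀ y, ψ y ≤ S
  sub_one_le : ∀ y, ψ y - 1 ≤ C * Real.exp (-b * |y|)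
  abs_deriv_le : ∀ y, |deriv ψ y| ≤ C * Real.exp (-b * |y|)
  abs_flux_le : ∀ y, |ψ y ^ (-2 * m) * deriv ψ y| ≤ C * Real.exp (-b * |y|)
  abs_deriv_flux_le : ∀ y,
    |deriv (fun z => ψ z ^ (-2 * m) * deriv ψ z) y| ≤ C * Real.exp (-b * |y|)

lemma gam_pos {n c : ℝ} (hn : 1 < n) (hc : n < c) : 0 < gam n c :=
  Real.sqrt_pos.mpr (div_pos (by linarith) (by linarith))

/-- Past the uniform entrance point `L`, ψ' ≤ -b(ψ - 1), so (ψ - 1)e^(by) decreases; before `L` the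
bound S is enough. Evenness covers the other half-line. -/
lemma exists_isLocalizedProfile {n m c₀ : ℝ} (hn : 1 < n) (hc₀ : n < c₀)
    (hwave : HasSolitaryWave n m c₀) :
    ∃ S C : ℝ, 1 < S ∧ 0 < C ∧ ∀ᶠ c in 𝓝 c₀, ∀ ψ, IsSolitaryWave n m c ψ →
      IsLocalizedProfile m (gam n c₀ / 2) C S ψ := by
  have hc0 : 0 < c₀ := by linarith
  obtain ⟨S, hS, hSev⟩ := exists_uniform_bound hn hc₀ hwave
  obtain ⟨δ, hδ, hδev⟩ := exists_potential_lower_bound (m := m) hn hc₀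
  obtain ⟨L, hL, hent⟩ := exists_uniform_entrance (m := m) (c₁ := c₀ / 2) (c₂ := 2 * c₀) hn
    (by linarith) (by linarith) hS hδ
  obtain ⟨M, hM, hMb⟩ := exists_bounds_by_excess (c₁ := c₀ / 2) m hn (by linarith) hS
  set b := gam n c₀ / 2 with hb
  have hb0 : 0 < b := half_pos (gam_pos hn hc₀)
  refine ⟨S, M * (S * Real.exp (b * L)), hS, by positivity, ?_⟩
  filter_upwards [hSev, hδev, Icc_mem_nhds (show c₀ / 2 < c₀ by linarith)
    (show c₀ < 2 * c₀ by linarith)] with c hcS hcδ hcI ψ h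
  have hcpos : 0 < c := by linarith [hcI.1]
  have hψS := hcS ψ h
  have hder : ∀ y, L ≤ y → deriv ψ y + b * (ψ y - 1) ≤ 0 := fun y hy => by
    have hx : 0 < ψ y - 1 := by linarith [h.one_lt y]
    have h1 := hcδ (ψ y) (h.one_lt y).le (hent c hcI ψ h hψS y hy)
    rw [← h.first_integral hcpos y] at h1
    have h2 : 2 / c * (ψ y ^ m) ^ 2 * (c / 2 * (ψ y ^ (-m) * deriv ψ y) ^ 2)
        = deriv ψ y ^ 2 := by
      have := Real.rpow_pos_of_pos (h.pos y) m
      rw [Real.rpow_neg (h.pos y).le]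
      field_simp
    rw [h2, ← mul_pow] at h1
    have h3 := sq_le_sq.mp h1
    rw [abs_of_pos (by positivity), abs_of_nonpos (h.deriv_nonpos hn hcpos (by linarith))] at h3
    linarith
  have hanti : AntitoneOn (fun y => (ψ y - 1) * Real.exp (b * y)) (Ici L) := by
    have hd : ∀ y, HasDerivAt (fun y => (ψ y - 1) * Real.exp (b * y))
        (deriv ψ y * Real.exp (b * y) + (ψ y - 1) * (Real.exp (b * y) * (b * 1))) y := fun y =>
      ((h.hasDerivAt y).sub_const 1).mul (((hasDerivAt_id y).const_mul b).exp)
    refine antitoneOn_of_deriv_nonpos (convex_Ici L)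
      (fun y _ => (hd y).continuousAt.continuousWithinAt)
      (fun y _ => (hd y).differentiableAt.differentiableWithinAt) fun y hy => ?_
    rw [(hd y).deriv]
    have := mul_nonpos_of_nonpos_of_nonneg (hder y (interior_subset hy)) (Real.exp_pos (b * y)).le
    linarith
  have hpos : ∀ y, 0 ≤ y → (ψ y - 1) * Real.exp (b * y) ≤ S * Real.exp (b * L) := fun y hy => by
    rcases le_total y L with hyL | hyL
    · have := hψS y
      have := h.one_lt y
      gcongr
      linarith
    · refine (hanti self_mem_Ici hyL hyL).trans ?_
      have := hψS L
      simp only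
      gcongr
      linarith
  have hexc : ∀ y, ψ y - 1 ≤ S * Real.exp (b * L) * Real.exp (-b * |y|) := fun y => by
    have habs : ψ y = ψ |y| := by
      rcases abs_choice y with e | e <;> rw [e]
      rw [h.even]
    have := hpos |y| (abs_nonneg y)
    rw [habs, neg_mul, Real.exp_neg, ← div_eq_mul_inv, le_div_iff₀ (Real.exp_pos _)]
    exact this
  have hM' : ∀ y, M * (ψ y - 1) ≤ M * (S * Real.exp (b * L)) * Real.exp (-b * |y|) := fun y => by
    have := mul_le_mul_of_nonneg_left (hexc y) (show 0 ≤ M by linarith)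
    linarith
  have hall := hMb c hcI.1 ψ h hψS
  refine ⟨h.smooth, h.one_lt, hψS, fun y => ?_, fun y => (hall y).1.trans (hM' y),
    fun y => (hall y).2.1.trans (hM' y), fun y => (hall y).2.2.trans (hM' y)⟩
  have : 0 < ψ y - 1 := by linarith [h.one_lt y]
  exact (by nlinarith : ψ y - 1 ≤ M * (ψ y - 1)).trans (hM' y)

/-! ### The density of the invariant functional -/

/-- The derivative of `potential`. -/
def potentialDeriv (n m s : ℝ) : ℝ :=
  if n + m = 1 then Real.log s else (1 - s ^ (1 - n - m)) / (n + m - 1)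

lemma potential_one (n m : ℝ) : potential n m 1 = 0 := by
  unfold potential
  split_ifs <;> simp

lemma potentialDeriv_one (n m : ℝ) : potentialDeriv n m 1 = 0 := by
  unfold potentialDeriv
  split_ifs <;> simp

lemma hasDerivAt_potential (n m : ℝ) {s : ℝ} (hs : 0 < s) :
    HasDerivAt (potential n m) (potentialDeriv n m s) s := by
  unfold potentialDeriv
  by_cases h1 : n + m = 1
  · have e : potential n m = fun s => s * Real.log s - s + 1 := by
      funext s; simp [potential, h1]
    rw [e, if_pos h1]
    refine ((((hasDerivAt_id s).mul (Real.hasDerivAt_log hs.ne')).sub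
      (hasDerivAt_id s)).add_const 1).congr_deriv ?_
    simp [hs.ne']
  · rw [if_neg h1]
    by_cases h2 : n + m = 2
    · have e : potential n m = fun s => s - 1 - Real.log s := by
        funext s; simp [potential, h2]
      rw [e]
      refine (((hasDerivAt_id s).sub_const 1).sub (Real.hasDerivAt_log hs.ne')).congr_deriv ?_
      rw [show 1 - n - m = -1 by linarith, Real.rpow_neg_one, show n + m - 1 = 1 by linarith]
      simp
    · have e : potential n m = fun s =>
          (s ^ (2 - n - m) - 1 + (n + m - 2) * (s - 1)) / ((n + m - 1) * (n + m - 2)) := by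
        funext s; simp [potential, h1, h2]
      rw [e]
      refine ((((Real.hasDerivAt_rpow_const (p := 2 - n - m) (Or.inl hs.ne')).sub_const 1).add
        (((hasDerivAt_id s).sub_const 1).const_mul (n + m - 2))).div_const _).congr_deriv ?_
      have h1' : n + m - 1 ≠ 0 := sub_ne_zero.mpr h1
      have h2' : n + m - 2 ≠ 0 := sub_ne_zero.mpr h2
      rw [show 2 - n - m - 1 = 1 - n - m by ring]
      field_simp
      ring

/-- All three cases of the potential share this second derivative, so the convexity estimates need
no case distinction. -/
lemma hasDerivAt_potentialDeriv (n m : ℝ) {s : ℝ} (hs : 0 < s) :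
    HasDerivAt (potentialDeriv n m) (s ^ (-n - m)) s := by
  by_cases h1 : n + m = 1
  · have e : potentialDeriv n m = Real.log := by
      funext s; simp [potentialDeriv, h1]
    rw [e, show -n - m = -1 by linarith, Real.rpow_neg_one]
    exact Real.hasDerivAt_log hs.ne'
  · have e : potentialDeriv n m = fun s => (1 - s ^ (1 - n - m)) / (n + m - 1) := by
      funext s; simp [potentialDeriv, h1]
    rw [e]
    refine (((Real.hasDerivAt_rpow_const (p := 1 - n - m) (Or.inl hs.ne')).const_sub 1).div_const
      _).congr_deriv ?_
    have h1' : n + m - 1 ≠ 0 := sub_ne_zero.mpr h1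
    rw [show 1 - n - m - 1 = -n - m by ring]
    field_simp
    ring

lemma measurable_potential (n m : ℝ) : Measurable (potential n m) := by
  unfold potential
  split_ifs <;> fun_prop

/-- The left end 1/2 is chosen for arguments ψ + v with ψ > 1 and |v| ≤ 1/2. -/
lemma exists_rpow_bounds (e S : ℝ) :
    ∃ k K : ℝ, 0 < k ∧ 0 < K ∧ ∀ s ∈ Icc (1 / 2) S, k ≤ s ^ e ∧ s ^ e ≤ K := by
  rcases (Icc (1 / 2) S).eq_empty_or_nonempty with hem | hne
  · exact ⟨1, 1, one_pos, one_pos, fun s hs => (hem ▸ hs : s ∈ (∅ : Set ℝ)).elim⟩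
  have hp : ∀ s ∈ Icc (1 / 2) S, 0 < s := fun s hs => by linarith [hs.1]
  have hc : ContinuousOn (fun s : ℝ => s ^ e) (Icc (1 / 2) S) :=
    continuousOn_id.rpow_const fun s hs => Or.inl (hp s hs).ne'
  obtain ⟨x, hx, hmin⟩ := isCompact_Icc.exists_isMinOn hne hc
  obtain ⟨z, hz, hmax⟩ := isCompact_Icc.exists_isMaxOn hne hc
  exact ⟨x ^ e, z ^ e, Real.rpow_pos_of_pos (hp x hx) e, Real.rpow_pos_of_pos (hp z hz) e,
    fun s hs => ⟨hmin hs, hmax hs⟩⟩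

lemma exists_rpow_lipschitz (e S : ℝ) :
    ∃ Λ : ℝ, 0 < Λ ∧ ∀ s ∈ Icc (1 / 2) S, ∀ t ∈ Icc (1 / 2) S, |t ^ e - s ^ e| ≤ Λ * |t - s| := by
  obtain ⟨k, K, _, hK, hb⟩ := exists_rpow_bounds (e - 1) S
  refine ⟨|e| * K + 1, by positivity, fun s hs t ht => ?_⟩
  have h := (convex_Icc (1 / 2) S).norm_image_sub_le_of_norm_hasDerivWithin_le
    (f := fun r : ℝ => r ^ e) (f' := fun r => e * r ^ (e - 1)) (C := |e| * K)
    (fun r hr => (Real.hasDerivAt_rpow_const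
      (Or.inl (by linarith [hr.1] : (0 : ℝ) < r).ne')).hasDerivWithinAt)
    (fun r hr => by
      rw [Real.norm_eq_abs, abs_mul,
        abs_of_pos (Real.rpow_pos_of_pos (by linarith [hr.1] : (0 : ℝ) < r) _)]
      exact mul_le_mul_of_nonneg_left (hb r hr).2 (abs_nonneg e)) hs ht
  simp only [Real.norm_eq_abs] at h
  nlinarith [abs_nonneg (t - s)]

lemma abs_potentialDeriv_le {n m S K : ℝ} (hS : 1 ≤ S)
    (hK : ∀ s ∈ Icc (1 / 2) S, s ^ (-n - m) ≤ K) {s : ℝ} (hs : s ∈ Icc (1 / 2) S) :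
    |potentialDeriv n m s| ≤ K * |s - 1| := by
  have h := (convex_Icc (1 / 2) S).norm_image_sub_le_of_norm_hasDerivWithin_le
    (f := potentialDeriv n m) (f' := fun r => r ^ (-n - m)) (C := K)
    (fun r hr => (hasDerivAt_potentialDeriv n m (by linarith [hr.1])).hasDerivWithinAt)
    (fun r hr => by
      rw [Real.norm_eq_abs,
        abs_of_pos (Real.rpow_pos_of_pos (by linarith [hr.1] : (0 : ℝ) < r) _)]
      exact hK r hr) (x := 1) ⟨by norm_num, hS⟩ hs
  simpa [Real.norm_eq_abs, potentialDeriv_one] using h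

lemma abs_potential_le {n m S K : ℝ} (hS : 1 ≤ S)
    (hK : ∀ s ∈ Icc (1 / 2) S, s ^ (-n - m) ≤ K) {s : ℝ} (hs : s ∈ Icc (1 / 2) S) :
    |potential n m s| ≤ K * (s - 1) ^ 2 := by
  have hK0 : 0 ≤ K := by
    have := hK 1 ⟨by norm_num, hS⟩
    rw [Real.one_rpow] at this
    linarith
  have h1 : (1 : ℝ) ∈ Icc (1 / 2) S := ⟨by norm_num, hS⟩
  have hsub : uIcc 1 s ⊆ Icc (1 / 2) S := uIcc_subset_Icc h1 hs
  have h := (convex_uIcc 1 s).norm_image_sub_le_of_norm_hasDerivWithin_le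
    (f := potential n m) (f' := potentialDeriv n m) (C := K * |s - 1|)
    (fun r hr => (hasDerivAt_potential n m (by linarith [(hsub hr).1])).hasDerivWithinAt)
    (fun r hr => by
      rw [Real.norm_eq_abs]
      refine (abs_potentialDeriv_le hS hK (hsub hr)).trans (mul_le_mul_of_nonneg_left ?_ hK0)
      exact abs_sub_left_of_mem_uIcc hr) left_mem_uIcc right_mem_uIcc
  rw [potential_one, sub_zero, Real.norm_eq_abs, Real.norm_eq_abs, mul_assoc,
    abs_mul_abs_self] at h
  linarith [sq (s - 1)]

/-- Subtracting (k/2)(r - s)² leaves a function with monotone derivative, which is convex and so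
lies above its tangent at s. -/
lemma potential_strongly_convex {n m S k : ℝ}
    (hk : ∀ s ∈ Icc (1 / 2) S, k ≤ s ^ (-n - m)) {s t : ℝ} (hs : s ∈ Icc (1 / 2) S)
    (ht : t ∈ Icc (1 / 2) S) :
    potentialDeriv n m s * (t - s) + k / 2 * (t - s) ^ 2 ≤ potential n m t - potential n m s := by
  set G : ℝ → ℝ := fun r => potential n m r - k / 2 * (r - s) ^ 2 with hG
  have hpos : ∀ r ∈ Icc (1 / 2) S, 0 < r := fun r hr => by linarith [hr.1]
  have hGd : ∀ r ∈ Icc (1 / 2) S, HasDerivAt G (potentialDeriv n m r - k * (r - s)) r :=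
    fun r hr => ((hasDerivAt_potential n m (hpos r hr)).sub
      ((((hasDerivAt_id r).sub_const s).pow 2).const_mul (k / 2))).congr_deriv (by simp; ring)
  have hG1 : ∀ r ∈ Icc (1 / 2) S,
      HasDerivAt (fun r => potentialDeriv n m r - k * (r - s)) (r ^ (-n - m) - k * 1) r :=
    fun r hr => (hasDerivAt_potentialDeriv n m (hpos r hr)).sub
      (((hasDerivAt_id r).sub_const s).const_mul k)
  have hmono : MonotoneOn (fun r => potentialDeriv n m r - k * (r - s)) (Icc (1 / 2) S) :=
    monotoneOn_of_deriv_nonneg (convex_Icc _ _)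
      (fun r hr => (hG1 r hr).continuousAt.continuousWithinAt)
      (fun r hr => (hG1 r (interior_subset hr)).differentiableAt.differentiableWithinAt)
      (fun r hr => by
        rw [(hG1 r (interior_subset hr)).deriv]
        linarith [hk r (interior_subset hr)])
  have hconv : ConvexOn ℝ (Icc (1 / 2) S) G := by
    refine MonotoneOn.convexOn_of_deriv (convex_Icc _ _)
      (fun r hr => (hGd r hr).continuousAt.continuousWithinAt)
      (fun r hr => (hGd r (interior_subset hr)).differentiableAt.differentiableWithinAt) ?_
    intro x hx z hz hxz
    rw [(hGd x (interior_subset hx)).deriv, (hGd z (interior_subset hz)).deriv]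
    exact hmono (interior_subset hx) (interior_subset hz) hxz
  have hGs : HasDerivAt G (potentialDeriv n m s) s :=
    (hGd s hs).congr_deriv (by ring)
  have hfin : potentialDeriv n m s * (t - s) ≤ G t - G s := by
    rcases lt_trichotomy s t with hst | hst | hst
    · have := hconv.le_slope_of_hasDerivAt hs ht hst hGs
      rw [slope_def_field, le_div_iff₀ (by linarith)] at this
      exact this
    · rw [hst]; simp
    · have := hconv.slope_le_of_hasDerivAt ht hs hst hGs
      rw [slope_def_field, div_le_iff₀ (by linarith)] at this
      linarith
  simp only [hG] at hfin
  linarith [hfin, show k / 2 * (s - s) ^ 2 = 0 by simp]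

/-- The excess of the density over its value at the profile, from below. -/
lemma exists_density_lower_bound (n m : ℝ) {S : ℝ} (hS : 1 ≤ S) :
    ∃ k Λ : ℝ, 0 < k ∧ 0 < Λ ∧ ∀ s ∈ Icc 1 S, ∀ v p q : ℝ, |v| ≤ 1 / 2 →
      k * (q ^ 2 + v ^ 2) + s ^ (-2 * m) * p * q - Λ * ((s - 1) + p ^ 2) * |v| ≤
        (1 / 2 * (s + v) ^ (-2 * m) * (p + q) ^ 2 + potential n m (s + v))
          - (1 / 2 * s ^ (-2 * m) * p ^ 2 + potential n m s) := by
  obtain ⟨d, _, hd, _, hdb⟩ := exists_rpow_bounds (-2 * m) (S + 1)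
  obtain ⟨κ, K, hκ, hK, hκb⟩ := exists_rpow_bounds (-n - m) (S + 1)
  obtain ⟨Λ, hΛ, hlip⟩ := exists_rpow_lipschitz (-2 * m) (S + 1)
  -- Of the available (d/2)q², one half absorbs the cross term (D' - D)pq by Young's inequality at
  -- the cost Λ²/d; κ/2 is the convexity of the potential. K bounds the linear term of the potential
  -- and Λ the variation of D. The term Dpq is kept exact, to be integrated by parts.
  refine ⟨min (d / 4) (κ / 2), K + Λ ^ 2 / d + Λ, by positivity, by positivity,
    fun s hs v p q hv => ?_⟩
  have hv' := abs_le.mp hv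
  have hsI : s ∈ Icc (1 / 2) (S + 1) := ⟨by linarith [hs.1], by linarith [hs.2]⟩
  have htI : s + v ∈ Icc (1 / 2) (S + 1) := ⟨by linarith [hs.1], by linarith [hs.2]⟩
  have h1 := potential_strongly_convex (fun r hr => (hκb r hr).1) hsI htI
  have h2 := abs_potentialDeriv_le (by linarith) (fun r hr => (hκb r hr).2) hsI
  have h3 := hlip s hsI (s + v) htI
  have h4 := (hdb (s + v) htI).1
  rw [add_sub_cancel_left] at h1 h3
  rw [abs_of_nonneg (show 0 ≤ s - 1 by linarith [hs.1])] at h2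
  set D' := (s + v) ^ (-2 * m)
  set D := s ^ (-2 * m)
  have h5 : -(K * (s - 1) * |v|) ≤ potentialDeriv n m s * v := by
    have : |potentialDeriv n m s * v| ≤ K * (s - 1) * |v| := by
      rw [abs_mul]
      exact mul_le_mul_of_nonneg_right h2 (abs_nonneg v)
    linarith [neg_abs_le (potentialDeriv n m s * v)]
  have h6 : -(Λ * |v| * p ^ 2) ≤ (D' - D) * p ^ 2 := by
    have := mul_le_mul_of_nonneg_right h3 (sq_nonneg p)
    have := mul_le_mul_of_nonneg_right (neg_abs_le (D' - D)) (sq_nonneg p)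
    linarith
  have h7 : -(d / 4 * q ^ 2 + Λ ^ 2 / d * (|v| * p ^ 2)) ≤ (D' - D) * p * q := by
    have e1 : |(D' - D) * p * q| ≤ Λ * |v| * |p| * |q| := by
      rw [abs_mul, abs_mul]
      gcongr
    have e2 : Λ * |v| * |p| * |q| ≤ d / 4 * q ^ 2 + Λ ^ 2 / d * (v ^ 2 * p ^ 2) := by
      have e3 : 0 ≤ d / 4 * (|q| - 2 * Λ / d * (|v| * |p|)) ^ 2 := by positivity
      have e4 : d / 4 * (|q| - 2 * Λ / d * (|v| * |p|)) ^ 2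
          = d / 4 * |q| ^ 2 + Λ ^ 2 / d * (|v| ^ 2 * |p| ^ 2) - Λ * |v| * |p| * |q| := by
        field_simp
        ring
      rw [e4, sq_abs, sq_abs, sq_abs] at e3
      linarith
    have e5 : v ^ 2 ≤ |v| := by
      rw [← sq_abs]
      nlinarith [abs_nonneg v]
    have e6 : Λ ^ 2 / d * (v ^ 2 * p ^ 2) ≤ Λ ^ 2 / d * (|v| * p ^ 2) := by gcongr
    linarith [neg_abs_le ((D' - D) * p * q)]
  have h8 : d * q ^ 2 ≤ D' * q ^ 2 := mul_le_mul_of_nonneg_right h4 (sq_nonneg q)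
  have h9 : min (d / 4) (κ / 2) * (q ^ 2 + v ^ 2) ≤ d / 4 * q ^ 2 + κ / 2 * v ^ 2 := by
    have := mul_le_mul_of_nonneg_right (min_le_left (d / 4) (κ / 2)) (sq_nonneg q)
    have := mul_le_mul_of_nonneg_right (min_le_right (d / 4) (κ / 2)) (sq_nonneg v)
    linarith
  have h10 : 0 ≤ (Λ ^ 2 / d + Λ) * ((s - 1) * |v|) :=
    mul_nonneg (by positivity) (mul_nonneg (by linarith [hs.1]) (abs_nonneg v))
  have h11 : 0 ≤ K * (p ^ 2 * |v|) := by positivity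
  have h12 : 0 ≤ Λ * (p ^ 2 * |v|) := by positivity
  have expand : (1 / 2 * D' * (p + q) ^ 2 + potential n m (s + v))
      - (1 / 2 * D * p ^ 2 + potential n m s)
      = 1 / 2 * (D' * q ^ 2) + D * p * q + (D' - D) * p * q + 1 / 2 * ((D' - D) * p ^ 2)
        + (potential n m (s + v) - potential n m s) := by ring
  rw [expand]
  linarith

lemma exists_density_bound (n m : ℝ) {S : ℝ} (hS : 1 ≤ S) :
    ∃ M : ℝ, 0 < M ∧ ∀ s ∈ Icc (1 / 2) S, ∀ p : ℝ,
      |1 / 2 * s ^ (-2 * m) * p ^ 2 + potential n m s| ≤ M * (p ^ 2 + (s - 1) ^ 2) := by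
  obtain ⟨_, d, _, hd, hdb⟩ := exists_rpow_bounds (-2 * m) S
  obtain ⟨_, K, _, hK, hKb⟩ := exists_rpow_bounds (-n - m) S
  refine ⟨d + K, by positivity, fun s hs p => (abs_add_le _ _).trans ?_⟩
  have h1 := abs_potential_le hS (fun r hr => (hKb r hr).2) hs
  have h2 := (hdb s hs).2
  have h3 := Real.rpow_pos_of_pos (show 0 < s by linarith [hs.1]) (-2 * m)
  rw [abs_of_nonneg (by positivity)]
  nlinarith [sq_nonneg p, sq_nonneg (s - 1), mul_le_mul_of_nonneg_right h2 (sq_nonneg p)]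

/-! ### Coercivity of the invariant functional modulo the weighted norm -/

lemma integrable_exp_neg_mul_abs {b : ℝ} (hb : 0 < b) :
    Integrable (fun y : ℝ => Real.exp (-b * |y|)) := by
  rw [← integrableOn_univ, ← Iic_union_Ioi (a := (0 : ℝ)), integrableOn_union]
  constructor
  · refine (integrableOn_exp_mul_Iic hb 0).congr_fun (fun y hy => ?_) measurableSet_Iic
    simp only
    rw [abs_of_nonpos hy]
    ring_nf
  · refine (exp_neg_integrableOn_Ioi 0 hb).congr_fun (fun y hy => ?_) measurableSet_Ioi
    simp only
    rw [abs_of_pos hy]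

lemma memLp_exp_neg_mul_abs {b : ℝ} (hb : 0 < b) :
    MemLp (fun y : ℝ => Real.exp (-b * |y|)) 2 volume := by
  rw [memLp_two_iff_integrable_sq (by fun_prop)]
  refine (integrable_exp_neg_mul_abs (b := 2 * b) (by linarith)).congr (ae_of_all _ fun y => ?_)
  simp only
  rw [← Real.exp_nat_mul]
  congr 1
  push_cast
  ring

lemma memLp_of_abs_le_exp {f : ℝ → ℝ} {b C : ℝ} (hb : 0 < b) (hf : Continuous f)
    (h : ∀ y, |f y| ≤ C * Real.exp (-b * |y|)) : MemLp f 2 volume :=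
  ((memLp_exp_neg_mul_abs hb).const_mul C).mono hf.aestronglyMeasurable
    (ae_of_all _ fun y => (h y).trans (le_abs_self _))

lemma tendsto_zero_of_abs_le_exp {f : ℝ → ℝ} {b C : ℝ} (hb : 0 < b)
    (h : ∀ y, |f y| ≤ C * Real.exp (-b * |y|)) {l : Filter ℝ}
    (hl : Tendsto (fun y : ℝ => |y|) l atTop) : Tendsto f l (𝓝 0) := by
  refine squeeze_zero_norm h ?_
  have : Tendsto (fun y : ℝ => b * |y|) l atTop := hl.const_mul_atTop hb
  simpa [neg_mul] using (Real.tendsto_exp_neg_atTop_nhds_zero.comp this).const_mul C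

/-- Since -a|y| ≤ ay, the one-sided weight still dominates on both half-lines: e^(-b|y|) ≤
e^(-(b-a)|y|) e^(ay). -/
lemma integral_exp_mul_abs_le {a b : ℝ} (ha : 0 < a) (hab : a < b) {v : ℝ → ℝ}
    (hv : MemLp v 2 volume) (hw : MemLp (weighted a v) 2 volume) :
    ∫ y, Real.exp (-b * |y|) * |v y| ≤
      l2Norm (fun y => Real.exp (-(b - a) * |y|)) * l2Norm (weighted a v) := by
  have he := memLp_exp_neg_mul_abs (sub_pos.mpr hab)
  refine le_trans ?_ (integral_abs_mul_le he hw)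
  refine integral_mono ((memLp_exp_neg_mul_abs (ha.trans hab)).integrable_mul hv.abs)
    (he.integrable_mul hw).abs fun y => ?_
  simp only [weighted]
  rw [abs_mul, abs_mul, abs_of_pos (Real.exp_pos _), abs_of_pos (Real.exp_pos _), ← mul_assoc,
    ← Real.exp_add]
  refine mul_le_mul_of_nonneg_right (Real.exp_le_exp.mpr ?_) (abs_nonneg _)
  nlinarith [neg_abs_le y]

lemma IsLocalizedProfile.contDiff_flux {m b C S : ℝ} {ψ : ℝ → ℝ}
    (h : IsLocalizedProfile m b C S ψ) :
    ContDiff ℝ 1 (fun y => ψ y ^ (-2 * m) * deriv ψ y) :=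
  ((h.smooth.of_le one_le_two).rpow_const_of_ne
    fun y => (one_pos.trans (h.one_lt y)).ne').mul
    (contDiff_succ_iff_deriv.mp
      (show ContDiff ℝ (1 + 1) ψ by simpa [one_add_one_eq_two] using h.smooth)).2.2

lemma integrable_density {n m S : ℝ} (hS : 1 ≤ S) {f g : ℝ → ℝ}
    (hf : AEStronglyMeasurable f volume) (hfS : ∀ᵐ y, f y ∈ Icc (1 / 2) S)
    (hf2 : MemLp (fun y => f y - 1) 2 volume) (hg : MemLp g 2 volume) :
    Integrable (fun y => 1 / 2 * f y ^ (-2 * m) * g y ^ 2 + potential n m (f y)) := by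
  obtain ⟨M, hM, hb⟩ := exists_density_bound n m hS
  refine ((hg.integrable_sq.add hf2.integrable_sq).const_mul M).mono' ?_ ?_
  · have h1 : AEMeasurable (fun y => f y ^ (-2 * m)) volume := hf.aemeasurable.pow_const _
    have h2 : AEMeasurable (fun y => potential n m (f y)) volume :=
      (measurable_potential n m).comp_aemeasurable hf.aemeasurable
    exact (((h1.const_mul _).mul (hg.1.aemeasurable.pow_const 2)).add h2).aestronglyMeasurable
  · filter_upwards [hfS] with y hy
    exact hb (f y) hy (g y)

/-- Integrate the pointwise lower bound. After an integration by parts every term linear in v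
carries a factor O(e^(-b|y|)) and is paid for by the weighted norm. -/
lemma exists_coercivity (n m : ℝ) {a b C S : ℝ} (ha : 0 < a) (hab : a < b) (hC : 0 < C)
    (hS : 1 < S) :
    ∃ k Λ : ℝ, 0 < k ∧ 0 < Λ ∧ ∀ ψ v : ℝ → ℝ, IsLocalizedProfile m b C S ψ →
      MemH1Weighted a v → h1Norm v ≤ 1 / 4 →
        k * h1Norm v ^ 2 ≤ energy n m (fun y => ψ y + v y) - energy n m ψ
          + Λ * l2Norm (weighted a v) := by
  obtain ⟨k, Λ, hk, hΛ, hdens⟩ := exists_density_lower_bound n m hS.le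
  have hb : 0 < b := ha.trans hab
  set N := l2Norm (fun y => Real.exp (-(b - a) * |y|)) with hN
  refine ⟨k, (C + Λ * (C + C ^ 2)) * (N + 1), hk,
    mul_pos (by positivity) (by linarith [l2Norm_nonneg (fun y => Real.exp (-(b - a) * |y|))]),
    fun ψ v h hv hsmall => ?_⟩
  have hψ1 : ContDiff ℝ 1 ψ := h.smooth.of_le one_le_two
  have hψc : Continuous ψ := hψ1.continuous
  -- The threshold 1/4 on the H¹ norm meets the embedding constant 2 here.
  have hvsmall : ∀ᵐ y, |v y| ≤ 1 / 2 := by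
    filter_upwards [hv.1.ae_abs_le] with y hy
    linarith
  have hψ2 : MemLp (fun y => ψ y - 1) 2 volume :=
    memLp_of_abs_le_exp hb (by fun_prop) fun y => by
      rw [abs_of_pos (by linarith [h.one_lt y])]
      exact h.sub_one_le y
  have hdψ2 : MemLp (deriv ψ) 2 volume :=
    memLp_of_abs_le_exp hb (hψ1.continuous_deriv le_rfl) h.abs_deriv_le
  set F : ℝ → ℝ := fun y => ψ y ^ (-2 * m) * deriv ψ y with hF
  have hFc := h.contDiff_flux
  have hF2 : MemLp F 2 volume := memLp_of_abs_le_exp hb hFc.continuous h.abs_flux_le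
  have hF2' : MemLp (deriv F) 2 volume :=
    memLp_of_abs_le_exp hb (hFc.continuous_deriv le_rfl) h.abs_deriv_flux_le
  set v' := weakDeriv v with hv'
  have hv2 := hv.1.1
  have hv2' : MemLp v' 2 volume := hv.1.memLp_weakDeriv
  have hE0 : energy n m ψ
      = ∫ y, (1 / 2 * ψ y ^ (-2 * m) * deriv ψ y ^ 2 + potential n m (ψ y)) := by
    refine integral_congr_ae ?_
    filter_upwards [(isWeakDeriv_deriv hψ1).weakDeriv_ae_eq] with y hy
    rw [hy]
  have hE1 : energy n m (fun y => ψ y + v y) = ∫ y, (1 / 2 * (ψ y + v y) ^ (-2 * m)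
      * (deriv ψ y + v' y) ^ 2 + potential n m (ψ y + v y)) := by
    refine integral_congr_ae ?_
    filter_upwards [((isWeakDeriv_deriv hψ1).add hv.1.isWeakDeriv).weakDeriv_ae_eq] with y hy
    rw [hy]
  have hI0 := integrable_density (n := n) (m := m) hS.le hψc.aestronglyMeasurable
    (ae_of_all _ fun y => ⟨by linarith [h.one_lt y], h.le y⟩) hψ2 hdψ2
  have hI1 := integrable_density (n := n) (m := m) (S := S + 1) (f := fun y => ψ y + v y)
    (g := fun y => deriv ψ y + v' y) (by linarith) (hψc.aestronglyMeasurable.add hv2.1)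
    (by filter_upwards [hvsmall] with y hy
        have := abs_le.mp hy
        exact ⟨by linarith [h.one_lt y], by linarith [h.le y]⟩)
    (by refine (hψ2.add hv2).congr_norm ?_ (ae_of_all _ fun y => ?_)
        · exact (hψc.aestronglyMeasurable.add hv2.1).sub aestronglyMeasurable_const
        · simp only [Pi.add_apply]; ring_nf) (hdψ2.add hv2')
  have hIF : Integrable (fun y => F y * v' y) := hF2.integrable_mul hv2'
  have hIF' : Integrable (fun y => deriv F y * v y) := hF2'.integrable_mul hv2
  have hIe : Integrable (fun y => Real.exp (-b * |y|) * |v y|) :=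
    (memLp_exp_neg_mul_abs hb).integrable_mul hv2.abs
  have hIq : Integrable (fun y => k * (v' y ^ 2 + v y ^ 2)) :=
    (hv2'.integrable_sq.add hv2.integrable_sq).const_mul k
  have hIqF : Integrable (fun y => k * (v' y ^ 2 + v y ^ 2) + F y * v' y) := hIq.add hIF
  have hparts : ∫ y, F y * v' y = -∫ y, deriv F y * v y := hv.1.integral_mul_weakDeriv hFc hF2 hF2'
    (tendsto_zero_of_abs_le_exp hb h.abs_flux_le tendsto_abs_atTop_atTop)
    (tendsto_zero_of_abs_le_exp hb h.abs_flux_le tendsto_abs_atBot_atTop)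
  have hle1 : ∫ y, deriv F y * v y ≤ C * ∫ y, Real.exp (-b * |y|) * |v y| := by
    rw [← integral_const_mul]
    refine integral_mono hIF' (hIe.const_mul C) fun y => ?_
    calc deriv F y * v y ≤ |deriv F y| * |v y| := (le_abs_self _).trans (abs_mul _ _).le
      _ ≤ C * Real.exp (-b * |y|) * |v y| :=
          mul_le_mul_of_nonneg_right (h.abs_deriv_flux_le y) (abs_nonneg _)
      _ = _ := by ring
  have hle2 : (∫ y, (k * (v' y ^ 2 + v y ^ 2) + F y * v' y
      - Λ * (C + C ^ 2) * (Real.exp (-b * |y|) * |v y|))) ≤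
      energy n m (fun y => ψ y + v y) - energy n m ψ := by
    rw [hE0, hE1, ← integral_sub hI1 hI0]
    refine integral_mono_ae (hIqF.sub (hIe.const_mul _)) (hI1.sub hI0) ?_
    filter_upwards [hvsmall] with y hy
    refine le_trans ?_ (hdens (ψ y) ⟨(h.one_lt y).le, h.le y⟩ (v y) (deriv ψ y) (v' y) hy)
    have e1 : (ψ y - 1) + deriv ψ y ^ 2 ≤ (C + C ^ 2) * Real.exp (-b * |y|) := by
      have f1 := h.sub_one_le y
      have f2 := h.abs_deriv_le y
      have f3 : Real.exp (-b * |y|) ≤ 1 := Real.exp_le_one_iff.mpr (by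
        have := abs_nonneg y
        nlinarith)
      have f4 := Real.exp_pos (-b * |y|)
      have f5 : deriv ψ y ^ 2 ≤ (C * Real.exp (-b * |y|)) ^ 2 := by
        rw [← sq_abs (deriv ψ y)]
        exact pow_le_pow_left₀ (abs_nonneg _) f2 2
      have f6 : C ^ 2 * Real.exp (-b * |y|) ^ 2 ≤ C ^ 2 * Real.exp (-b * |y|) :=
        mul_le_mul_of_nonneg_left (by nlinarith) (sq_nonneg C)
      nlinarith
    have e2 : Λ * ((ψ y - 1) + deriv ψ y ^ 2) * |v y|
        ≤ Λ * ((C + C ^ 2) * Real.exp (-b * |y|)) * |v y| := by gcongr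
    simp only [hF]
    linarith
  rw [integral_sub hIqF (hIe.const_mul _), integral_add hIq hIF,
    integral_const_mul, integral_const_mul, integral_add hv2'.integrable_sq hv2.integrable_sq,
    hparts] at hle2
  have hw := integral_exp_mul_abs_le ha hab hv2 hv.2.1
  rw [h1Norm_sq]
  have hpos : 0 ≤ l2Norm (weighted a v) := l2Norm_nonneg _
  have hw2 : (C + Λ * (C + C ^ 2)) * ∫ y, Real.exp (-b * |y|) * |v y|
      ≤ (C + Λ * (C + C ^ 2)) * ((N + 1) * l2Norm (weighted a v)) :=
    mul_le_mul_of_nonneg_left (by linarith) (by positivity)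
  linarith

/-- A nonzero `deriv` forces differentiability, because `deriv` is 0 by default elsewhere. -/
lemma exists_energy_lipschitz {n m c₀ : ℝ} (h : energySlope n m c₀ ≠ 0) :
    ∃ K : ℝ, 0 < K ∧ ∀ᶠ c in 𝓝 c₀,
      |energy n m (solitaryWave n m c) - energy n m (solitaryWave n m c₀)| ≤ K * |c - c₀| := by
  have hd : DifferentiableAt ℝ (fun s => energy n m (solitaryWave n m s)) c₀ := by
    by_contra hnd
    exact h (deriv_zero_of_not_differentiableAt hnd)
  obtain ⟨K, hK, hb⟩ := hd.hasFDerivAt.isBigO_sub.exists_pos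
  exact ⟨K, hK, by simpa [Asymptotics.IsBigOWith, Real.norm_eq_abs] using hb⟩

end Magma

end

/-! ### Assembling the estimate -/

theorem mainTheorem10 (n m c₀ a : ℝ) (hn : 1 < n) (hc₀ : n < c₀)
    (hwave : Magma.HasSolitaryWave n m c₀)
    (ha : 0 < a) (haStar : a ≤ Magma.aStar n m c₀)
    (hslope : Magma.energySlope n m c₀ ≠ 0) :
    ∃ K K' : ℝ, 0 < K ∧ 0 < K' ∧
      ∀ (T δ₁ θ₀ : ℝ) (φ v : ℝ → ℝ → ℝ) (v₀ θ c : ℝ → ℝ),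
        0 < T → δ₁ < 1 →
        Magma.IsSolution n m a T φ →
        (∀ x, φ 0 x = Magma.solitaryWave n m c₀ (x + θ₀) + v₀ x) →
        Magma.IsDecomposition n m c₀ a T φ v θ c →
        (∀ t ∈ Set.Icc 0 T, |c t - c₀| + Magma.h1Norm (v t) ≤ δ₁) →
        ∀ t ∈ Set.Icc 0 T,
          Magma.h1Norm (v t) ^ 2 * (1 - K' * Magma.h1Norm (v t)) ≤
            K * (|Magma.energy n m (fun y => Magma.solitaryWave n m (c t) y + v t y)
                    - Magma.energy n m (Magma.solitaryWave n m c₀)|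
                  + Magma.l2Norm (Magma.weighted a (v t))
                  + Magma.l2Norm (Magma.weighted a (v t)) ^ 2
                  + |c t - c₀| + |c t - c₀| ^ 2 + |c t - c₀| ^ 3) := by
  obtain ⟨S, C, hS, hC, hloc⟩ := Magma.exists_isLocalizedProfile hn hc₀ hwave
  have hgam := Magma.gam_pos hn hc₀
  have hab : a < Magma.gam n c₀ / 2 := by
    have : a ≤ 1 / 3 * Magma.gam n c₀ := haStar.trans (min_le_left _ _)
    linarith
  obtain ⟨k, Λ, hk, hΛ, hcoer⟩ := Magma.exists_coercivity n m ha hab hC hS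
  obtain ⟨K₀, hK₀, hlip⟩ := Magma.exists_energy_lipschitz hslope
  obtain ⟨ε, hε, hball⟩ := Metric.eventually_nhds_iff.mp (hloc.and hlip)
  -- K' = 4 makes the left side nonpositive once ‖v‖ ≥ 1/4, and 1/ε handles |c - c₀| ≥ ε, where ‖v‖²
  -- ≤ 1 is enough. The first summand comes from coercivity in the remaining case.
  refine ⟨(1 + Λ + K₀) / k + 1 / ε, 4, by positivity, by norm_num, ?_⟩
  intro T δ₁ θ₀ φ v v₀ θ c _ hδ₁ _ _ hdec hsmall t ht
  have hst := hsmall t ht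
  set h := Magma.h1Norm (v t)
  have hh0 : 0 ≤ h := Magma.h1Norm_nonneg _
  set w := Magma.l2Norm (Magma.weighted a (v t))
  have hw0 : 0 ≤ w := Magma.l2Norm_nonneg _
  set d := |c t - c₀| with hd
  have hd0 : 0 ≤ d := abs_nonneg _
  set Δ := Magma.energy n m (fun y => Magma.solitaryWave n m (c t) y + v t y)
    - Magma.energy n m (Magma.solitaryWave n m c₀) with hΔ
  have hΔ0 : 0 ≤ |Δ| := abs_nonneg _
  have hrest : 0 ≤ w ^ 2 + d ^ 2 + d ^ 3 := by positivity
  have hred : h ^ 2 * (1 - 4 * h) ≤ h ^ 2 := by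
    have : 0 ≤ h ^ 2 * h := by positivity
    linarith
  rcases le_or_gt (1 / 4) h with hbig | hh
  · refine le_trans (mul_nonpos_of_nonneg_of_nonpos (sq_nonneg h) (by linarith)) ?_
    positivity
  refine hred.trans ?_
  rcases le_or_gt ε d with hbig | hdε
  · calc h ^ 2 ≤ 1 := by nlinarith
      _ ≤ 1 / ε * d := by rw [one_div, inv_mul_eq_div, one_le_div hε]; exact hbig
      _ ≤ ((1 + Λ + K₀) / k + 1 / ε) * (|Δ| + w + w ^ 2 + d + d ^ 2 + d ^ 3) :=
          mul_le_mul (by linarith [show 0 < (1 + Λ + K₀) / k by positivity]) (by linarith) hd0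
            (by positivity)
  · have hnear := hball (y := c t) (by rw [Real.dist_eq]; exact hdε)
    -- The chosen `solitaryWave` is a genuine profile because one exists at speed c t.
    have hprof := hnear.1 _ (Classical.epsilon_spec (hdec.wave t ht))
    have hc := hcoer _ _ hprof (hdec.mem t ht) hh.le
    have hl := abs_le.mp hnear.2
    have h1 : k * h ^ 2 ≤ |Δ| + K₀ * d + Λ * w := by
      have e1 := le_abs_self Δ
      have e2 := hl.1
      simp only [Magma.solitaryWave] at hc hΔ e2 ⊢
      linarith
    have h2 : h ^ 2 ≤ (|Δ| + K₀ * d + Λ * w) / k := by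
      rw [le_div_iff₀ hk]
      linarith
    have h3 : |Δ| + K₀ * d + Λ * w ≤ (1 + Λ + K₀) * (|Δ| + w + w ^ 2 + d + d ^ 2 + d ^ 3) := by
      have g1 : 0 ≤ (Λ + K₀) * |Δ| := by positivity
      have g2 : 0 ≤ (1 + K₀) * w := by positivity
      have g3 : 0 ≤ (1 + Λ) * d := by positivity
      have g4 : 0 ≤ (1 + Λ + K₀) * (w ^ 2 + d ^ 2 + d ^ 3) := by positivity
      linarith
    calc h ^ 2 ≤ (1 + Λ + K₀) * (|Δ| + w + w ^ 2 + d + d ^ 2 + d ^ 3) / k :=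
          h2.trans (by gcongr)
      _ = (1 + Λ + K₀) / k * (|Δ| + w + w ^ 2 + d + d ^ 2 + d ^ 3) := by ring
      _ ≤ _ := mul_le_mul_of_nonneg_right
          (by linarith [show 0 < 1 / ε by positivity]) (by positivity)
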